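/- Let $\mathbb{B}=\{q\in\mathbb{H} : |q|<1\}$ be the open unit ball of the quaternions and $\mathbb{S}=\{I\in\mathbb{H} : I^2=-1\}$. A function $f:\mathbb{B}\to\mathbb{H}$ is slice regular if for every $I\in\mathbb{S}$ its restriction to $\mathbb{B}\cap(\mathbb{R}+I\mathbb{R})$ is real differentiable and $\frac12\left(\frac{\partial}{\partial x}+I\frac{\partial}{\partial y}\right)f(x+Iy)=0$ there. Such an $f$ has a unique expansion $f(q)=\sum_n q^n a_n$ in $\mathbb{B}$ with $a_n\in\mathbb{H}$. For $g(q)=\sum_n q^n b_n$ slice regular as well, put $$f*g(q)=\sum_n q^n\sum_{k=0}^n a_k b_{n-k},\qquad f^c(q)=\sum_n q^n\bar a_n,\qquad f^s=f*f^c,$$ and let $f^{-*}*g(q)=f^s(q)^{-1}\,(f^c*g)(q)$ for the $q\in\mathbb{B}$ with $f^s(q)\neq 0$. In formulas such as $\bar q_0*f(q)$, constants are regarded as constant functions and $q$ denotes the variable. For $q_0\in\mathbb{B}$ and $f$ slice regular, let - $\partial_c f(x+Iy)=\frac12\left(\frac{\partial}{\partial x}-I\frac{\partial}{\partial y}\right)f(x+Iy)$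 (Cullen derivative; $x,y\in\mathbb{R}$, $I\in\mathbb{S}$); - $\partial_s f(q_0)=(2\,\mathrm{Im}\,q_0)^{-1}\left(f(q_0)-f(\bar q_0)\right)$ if $q_0\notin\mathbb{R}$, and $\partial_s f(q_0)=\partial_c f(q_0)$ if $q_0\in\mathbb{R}$ (spherical derivative); - $R_{q_0}f(q)=(q-q_0)^{-*}*(f(q)-f(q_0))$, extended by continuity to all of $\mathbb{B}$ (differential quotient). Theorem. Let $f:\mathbb{B}\to\mathbb{B}$ be a slice regular function and suppose that $f$ has a fixed point $q_0\in\mathbb{B}$. The following facts are equivalent: 1. $f$ coincides with the identity function on $\mathbb{B}$; 2. $f$ is real differentiable at $q_0$ and its real differential at $q_0$ is the identity; 3. $\partial_c f(q_0)=1$; 4. $\partial_s f(q_0)=1$; 5. there is a $q\in\mathbb{B}$ at which $R_{q_0}f(q)=(1-\bar q_0*q)^{-*}*(1-\bar q_0*f(q))$. -/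

import Mathlib

open scoped Quaternion Topology

noncomputable section

namespace SliceRegular

/-- The open unit ball `𝔹` of the quaternions. -/
def unitBall : Set ℍ[ℝ] := Metric.ball 0 1

/-- The sphere `𝕊` of imaginary units. -/
def imaginaryUnits : Set ℍ[ℝ] := {I | I ^ 2 = -1}

/-- `∂f/∂x` at the point `x + I y` of the slice `ℝ + I ℝ`. -/
def partialX (f : ℍ[ℝ] → ℍ[ℝ]) (I : ℍ[ℝ]) (x y : ℝ) : ℍ[ℝ] :=
  deriv (fun s : ℝ => f ((s : ℍ[ℝ]) + I * (y : ℍ[ℝ]))) x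

/-- `∂f/∂y` at the point `x + I y` of the slice `ℝ + I ℝ`. -/
def partialY (f : ℍ[ℝ] → ℍ[ℝ]) (I : ℍ[ℝ]) (x y : ℝ) : ℍ[ℝ] :=
  deriv (fun t : ℝ => f ((x : ℍ[ℝ]) + I * (t : ℍ[ℝ]))) y

/-- Slice regularity of `f` on an open set `Ω`: for every imaginary unit `I`, the restriction
of `f` to `Ω ∩ (ℝ + I ℝ)` is real differentiable and `(1/2) (∂/∂x + I ∂/∂y) f` vanishes there. -/
def SliceRegularOn (f : ℍ[ℝ] → ℍ[ℝ]) (Ω : Set ℍ[ℝ]) : Prop :=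
  ∀ I ∈ imaginaryUnits, ∀ x y : ℝ, (x : ℍ[ℝ]) + I * (y : ℍ[ℝ]) ∈ Ω →
    DifferentiableAt ℝ (fun p : ℝ × ℝ => f ((p.1 : ℍ[ℝ]) + I * (p.2 : ℍ[ℝ]))) (x, y) ∧
    (1 / 2 : ℝ) • (partialX f I x y + I * partialY f I x y) = 0

/-- The imaginary unit `i`. -/
def unitI : ℍ[ℝ] := ⟨0, 1, 0, 0⟩

/-- An imaginary unit `I` with `q = Re q + I |Im q|`; the unit `i` is taken when `q` is real. -/
def unitOf (q : ℍ[ℝ]) : ℍ[ℝ] :=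
  open Classical in if q.im = 0 then unitI else (‖q.im‖⁻¹ : ℝ) • q.im

/-- The Cullen derivative `∂_c f (x + I y) = (1/2) (∂/∂x - I ∂/∂y) f (x + I y)`. For slice regular
`f` it does not depend on how `q` is written as `x + I y`, see `cullenDeriv_eq`. -/
def cullenDeriv (f : ℍ[ℝ] → ℍ[ℝ]) (q : ℍ[ℝ]) : ℍ[ℝ] :=
  (1 / 2 : ℝ) •
    (partialX f (unitOf q) q.re ‖q.im‖ - unitOf q * partialY f (unitOf q) q.re ‖q.im‖)

/-- The spherical derivative `∂_s f (q) = (2 Im q)⁻¹ (f q - f (conj q))`; at a real point, where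
this quotient has no meaning, its value is the Cullen derivative, which is the limit of the
quotients when `f` is slice regular. -/
def sphericalDeriv (f : ℍ[ℝ] → ℍ[ℝ]) (q : ℍ[ℝ]) : ℍ[ℝ] :=
  open Classical in
  if q.im = 0 then cullenDeriv f q else (2 * q.im)⁻¹ * (f q - f (star q))

/-- `f(q) = ∑ qⁿ aₙ` in the unit ball. -/
def HasExpansion (f : ℍ[ℝ] → ℍ[ℝ]) (a : ℕ → ℍ[ℝ]) : Prop :=
  ∀ q ∈ unitBall, HasSum (fun n => q ^ n * a n) (f q)

/-- The power series `∑ tⁿ cₙ` of a real variable `t`; it serves only to show that the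
coefficients of an expansion are unique. -/
def realSeries (c : ℕ → ℍ[ℝ]) : FormalMultilinearSeries ℝ ℝ ℍ[ℝ] :=
  fun n => ContinuousMultilinearMap.mkPiRing ℝ (Fin n) (c n)

theorem HasExpansion.unique {f : ℍ[ℝ] → ℍ[ℝ]} {a b : ℕ → ℍ[ℝ]}
    (ha : HasExpansion f a) (hb : HasExpansion f b) : a = b := by
  have key : ∀ c : ℕ → ℍ[ℝ], HasExpansion f c →
      HasFPowerSeriesAt (fun t : ℝ => f (t : ℍ[ℝ])) (realSeries c) 0 := by
    intro c hc
    rw [hasFPowerSeriesAt_iff]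
    filter_upwards [Metric.ball_mem_nhds (0 : ℝ) one_pos] with t ht
    have h1 : (t : ℍ[ℝ]) ∈ unitBall := by
      simpa [unitBall, Metric.mem_ball] using ht
    have h2 := hc _ h1
    have h3 : (fun n => t ^ n • (realSeries c).coeff n) = fun n => (t : ℍ[ℝ]) ^ n * c n := by
      funext n
      simp [realSeries, FormalMultilinearSeries.coeff, ← Quaternion.coe_pow,
        Quaternion.coe_mul_eq_smul]
    rw [h3, zero_add]
    exact h2
  have h := (key a ha).eq_formalMultilinearSeries (key b hb)
  funext n
  have h3 := congrArg (fun p : FormalMultilinearSeries ℝ ℝ ℍ[ℝ] => p.coeff n) h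
  simpa [realSeries, FormalMultilinearSeries.coeff] using h3

/-- The coefficients `aₙ` of `f(q) = ∑ qⁿ aₙ`; junk value `0` without such an expansion. -/
def coeff (f : ℍ[ℝ] → ℍ[ℝ]) : ℕ → ℍ[ℝ] :=
  open Classical in if h : ∃ a, HasExpansion f a then h.choose else 0

theorem coeff_eq {f : ℍ[ℝ] → ℍ[ℝ]} {a : ℕ → ℍ[ℝ]} (h : HasExpansion f a) : coeff f = a := by
  have h' : ∃ a, HasExpansion f a := ⟨a, h⟩
  rw [coeff, dif_pos h']
  exact h'.choose_spec.unique h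

/-- The regular product `f * g (q) = ∑ qⁿ ∑_{k ≤ n} a_k b_{n-k}` on the unit ball. -/
def regMul (f g : ℍ[ℝ] → ℍ[ℝ]) (q : ℍ[ℝ]) : ℍ[ℝ] :=
  ∑' n : ℕ, q ^ n * ∑ k ∈ Finset.range (n + 1), coeff f k * coeff g (n - k)

/-- The regular conjugate `f^c(q) = ∑ qⁿ conj(aₙ)`. -/
def regConj (f : ℍ[ℝ] → ℍ[ℝ]) (q : ℍ[ℝ]) : ℍ[ℝ] :=
  ∑' n : ℕ, q ^ n * star (coeff f n)

/-- The symmetrization `f^s = f * f^c`. -/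
def regSymm (f : ℍ[ℝ] → ℍ[ℝ]) : ℍ[ℝ] → ℍ[ℝ] := regMul f (regConj f)

/-- The domain of definition `𝔹 ∖ Z(f^s)` of the left regular quotients with denominator `f`. -/
def quotientDomain (f : ℍ[ℝ] → ℍ[ℝ]) : Set ℍ[ℝ] := {q | q ∈ unitBall ∧ regSymm f q ≠ 0}

/-- The left regular quotient `f^{-*} * g (q) = f^s(q)⁻¹ (f^c * g)(q)`; it is meaningful for `q`
in `quotientDomain f`. -/
def leftQuotient (f g : ℍ[ℝ] → ℍ[ℝ]) (q : ℍ[ℝ]) : ℍ[ℝ] :=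
  (regSymm f q)⁻¹ * regMul (regConj f) g q

/-- The differential quotient `R_{q₀} f (q) = (q - q₀)^{-*} * (f(q) - f(q₀))`, as a function on the
whole unit ball: `extendFrom` extends the quotient by continuity from its domain of definition to
the sphere `{x + y I : I ∈ 𝕊}` through `q₀ = x + y I₀`. -/
def diffQuotient (f : ℍ[ℝ] → ℍ[ℝ]) (q₀ : ℍ[ℝ]) : ℍ[ℝ] → ℍ[ℝ] :=
  extendFrom (quotientDomain fun q => q - q₀) (leftQuotient (fun q => q - q₀) fun q => f q - f q₀)

theorem cullenDeriv_eq {f : ℍ[ℝ] → ℍ[ℝ]} {Ω : Set ℍ[ℝ]} (hf : SliceRegularOn f Ω)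
    {I : ℍ[ℝ]} (hI : I ∈ imaginaryUnits) {x y : ℝ} (hxy : (x : ℍ[ℝ]) + I * (y : ℍ[ℝ]) ∈ Ω) :
    cullenDeriv f ((x : ℍ[ℝ]) + I * (y : ℍ[ℝ])) =
      (1 / 2 : ℝ) • (partialX f I x y - I * partialY f I x y) := by
  have hI2 : I * I = -1 := by rw [← sq]; exact hI
  have hIre : I.re = 0 ∧ ‖I‖ = 1 := by
    have hn : ‖I‖ = 1 := by
      have h1 : ‖I‖ * ‖I‖ = 1 := by rw [← norm_mul, hI2]; simp
      nlinarith [norm_nonneg I]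
    refine ⟨?_, hn⟩
    have e1 := congrArg QuaternionAlgebra.re hI2
    have e2 : I.re ^ 2 + I.imI ^ 2 + I.imJ ^ 2 + I.imK ^ 2 = 1 := by
      rw [← Quaternion.normSq_def', Quaternion.normSq_eq_norm_mul_self, hn]; norm_num
    simp at e1
    nlinarith
  obtain ⟨h0, hn⟩ := hIre
  have him : I.im = I := by ext <;> simp [h0]
  have hre : ((x : ℍ[ℝ]) + I * (y : ℍ[ℝ])).re = x := by simp [h0]
  have him' : ((x : ℍ[ℝ]) + I * (y : ℍ[ℝ])).im = y • I := by
    rw [Quaternion.mul_coe_eq_smul]; ext <;> simp [h0]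
  have hnorm : ‖((x : ℍ[ℝ]) + I * (y : ℍ[ℝ])).im‖ = |y| := by
    rw [him', norm_smul, hn]; simp
  have hI0 : I ≠ 0 := by rintro rfl; simp at hn
  rcases lt_trichotomy y 0 with hy | hy | hy
  · have hu : unitOf ((x : ℍ[ℝ]) + I * (y : ℍ[ℝ])) = -I := by
      rw [unitOf, if_neg (by rw [him']; simp [hy.ne, hI0]), hnorm, him', smul_smul,
        abs_of_neg hy, inv_neg, neg_mul, inv_mul_cancel₀ hy.ne]; simp
    rw [cullenDeriv, hu, hre, hnorm, abs_of_neg hy]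
    have hX : partialX f (-I) x (-y) = partialX f I x y := by
      simp [partialX]
    have hY : partialY f (-I) x (-y) = -partialY f I x y := by
      have := deriv_comp_neg (fun t : ℝ => f ((x : ℍ[ℝ]) + I * (t : ℍ[ℝ]))) (-y)
      simpa [partialY] using this
    rw [hX, hY, neg_mul_neg]
  · subst hy
    have hu : unitOf ((x : ℍ[ℝ]) + I * ((0 : ℝ) : ℍ[ℝ])) = unitI := by
      rw [unitOf, if_pos (by rw [him']; simp)]
    have hi' : unitI ∈ imaginaryUnits := by
      have c0 : unitI.re = 0 := rfl
      have c1 : unitI.imI = 1 := rfl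
      have c2 : unitI.imJ = 0 := rfl
      have c3 : unitI.imK = 0 := rfl
      change unitI ^ 2 = -1
      rw [sq]; ext <;> simp [c0, c1, c2, c3]
    rw [cullenDeriv, hu, hre, hnorm, abs_zero]
    have a1 := (hf I hI x 0 hxy).2
    have a2 := (hf unitI hi' x 0 (by simpa using hxy)).2
    have hX : partialX f unitI x 0 = partialX f I x 0 := by simp [partialX]
    have two : (1 / 2 : ℝ) ≠ 0 := by norm_num
    have b1 := (smul_eq_zero.mp a1).resolve_left two
    have b2 := (smul_eq_zero.mp a2).resolve_left two
    rw [eq_neg_of_add_eq_zero_right b1, eq_neg_of_add_eq_zero_right b2, hX]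
  · have hu : unitOf ((x : ℍ[ℝ]) + I * (y : ℍ[ℝ])) = I := by
      rw [unitOf, if_neg (by rw [him']; simp [hy.ne', hI0]), hnorm, him', smul_smul,
        abs_of_pos hy, inv_mul_cancel₀ hy.ne', one_smul]
    rw [cullenDeriv, hu, hre, hnorm, abs_of_pos hy]

end SliceRegular

end

/-!
A slice regular `f` is a power series `∑ qⁿ aₙ`. The real-linear operators `w ↦ ∑ qⁿ w aₙ` turn the
regular product into composition, and for `q` in the slice `ℝ + iℝ` they are holomorphic in `q` with
respect to the complex structure on `ℍ` given by left multiplication. Every quaternion is conjugate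
to one in the slice, so the identity theorem, the maximum principle and the inversion of zero-free
series are inherited from one complex variable.

Let `G` be the differential quotient of `f` at the fixed point, `f - q₀ = (q - q₀) * G`. The Cullen
derivative is `G(q₀)` and the spherical derivative is `G(q̄₀)`, while condition 5 at `q` says that
`G` takes the value `1` at a conjugate of `q`; so it remains to prove that `G` is constantly `1` as
soon as it takes the value `1`. Put `H = (1 - q̄₀ * q) * G * (1 - q̄₀ * f)^{-*}`. Then `|H|` is
bounded near the unit sphere by `(2 - |q|² - |q₀|²) / (|q|² - |q₀|²)`, hence `|H| ≤ 1` by the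
maximum principle, and `(1 - H) * (1 - q̄₀ * f) = (1 - |q₀|²) (1 - G)`. If `G` takes the value `1`,
then so does `H`, so that `H` is constantly `1`, and therefore `G` is.
-/

open PowerSeries (X C)
open Quaternion (coeComplex)

noncomputable section

namespace SliceRegular

variable {A B : PowerSeries ℍ[ℝ]} {q : ℍ[ℝ]}

theorem mem_unitBall : q ∈ unitBall ↔ ‖q‖ < 1 := by
  simp [unitBall]

theorem norm_inv_mul_mul (q : ℍ[ℝ]) {w : ℍ[ℝ]} (hw : w ≠ 0) : ‖w⁻¹ * q * w‖ = ‖q‖ := by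
  rw [norm_mul, norm_mul, norm_inv]
  field_simp [norm_ne_zero_iff.mpr hw]

/-- The coefficients of `A` satisfy the growth condition that makes `∑ qⁿ aₙ` converge absolutely
in the unit ball. -/
def ConvergesOnBall (A : PowerSeries ℍ[ℝ]) : Prop :=
  ∀ r : ℝ, 0 ≤ r → r < 1 → Summable fun n => r ^ n * ‖PowerSeries.coeff n A‖

/-- The sum `∑ qⁿ w aₙ`. For `w ≠ 0` it is `w A(w⁻¹ q w)`; the operators `w ↦ ∑ qⁿ w aₙ` turn the
regular product into composition. -/
def twistedEval (A : PowerSeries ℍ[ℝ]) (q w : ℍ[ℝ]) : ℍ[ℝ] :=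
  ∑' n, q ^ n * w * PowerSeries.coeff n A

theorem norm_pow_mul_mul_coeff (A : PowerSeries ℍ[ℝ]) (q w : ℍ[ℝ]) (n : ℕ) :
    ‖q ^ n * w * PowerSeries.coeff n A‖ = ‖w‖ * (‖q‖ ^ n * ‖PowerSeries.coeff n A‖) := by
  rw [norm_mul, norm_mul, norm_pow]; ring

namespace ConvergesOnBall

theorem summable_norm (hA : ConvergesOnBall A) (hq : ‖q‖ < 1) (w : ℍ[ℝ]) :
    Summable fun n => ‖q ^ n * w * PowerSeries.coeff n A‖ := by
  simp_rw [norm_pow_mul_mul_coeff]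
  exact (hA _ (norm_nonneg q) hq).mul_left _

theorem hasSum (hA : ConvergesOnBall A) (hq : ‖q‖ < 1) (w : ℍ[ℝ]) :
    HasSum (fun n => q ^ n * w * PowerSeries.coeff n A) (twistedEval A q w) :=
  (hA.summable_norm hq w).of_norm.hasSum

theorem of_norm_le (hA : ConvergesOnBall A)
    (h : ∀ n, ‖PowerSeries.coeff n B‖ ≤ ‖PowerSeries.coeff n A‖) : ConvergesOnBall B := by
  intro r h0 h1
  refine (hA r h0 h1).of_nonneg_of_le (fun n => by positivity) fun n => ?_
  gcongr
  exact h n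

theorem of_bddAbove
    (h : ∀ r : ℝ, 0 ≤ r → r < 1 → BddAbove (Set.range fun n => r ^ n * ‖PowerSeries.coeff n A‖)) :
    ConvergesOnBall A := by
  intro r h0 h1
  obtain ⟨s, hrs, hs⟩ := exists_between h1
  have hs0 : 0 < s := h0.trans_lt hrs
  obtain ⟨M, hM⟩ := h s hs0.le hs
  have hgeom := (summable_geometric_of_lt_one (div_nonneg h0 hs0.le)
    ((div_lt_one hs0).mpr hrs)).mul_left M
  refine hgeom.of_nonneg_of_le (fun n => by positivity) fun n => ?_
  calc r ^ n * ‖PowerSeries.coeff n A‖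
      = s ^ n * ‖PowerSeries.coeff n A‖ * (r / s) ^ n := by rw [div_pow]; field_simp
    _ ≤ M * (r / s) ^ n := by gcongr; exact hM (Set.mem_range_self n)

theorem of_summable (h : ∀ q : ℍ[ℝ], ‖q‖ < 1 → Summable fun n => q ^ n * PowerSeries.coeff n A) :
    ConvergesOnBall A := by
  refine of_bddAbove fun r h0 h1 => ?_
  have hr : ‖(r : ℍ[ℝ])‖ < 1 := by simpa [abs_of_nonneg h0] using h1
  simpa [abs_of_nonneg h0] using (h r hr).tendsto_atTop_zero.norm.bddAbove_range

theorem of_eventually_coeff_eq_zero (h : ∀ᶠ n in Filter.atTop, PowerSeries.coeff n A = 0) :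
    ConvergesOnBall A := by
  obtain ⟨N, hN⟩ := Filter.eventually_atTop.mp h
  refine fun r _ _ => summable_of_ne_finset_zero (s := Finset.range N) fun n hn => ?_
  rw [hN n (by simpa using hn), norm_zero, mul_zero]

theorem const (c : ℍ[ℝ]) : ConvergesOnBall (C c) :=
  of_eventually_coeff_eq_zero <| (Filter.eventually_gt_atTop 0).mono fun n hn => by
    rw [PowerSeries.coeff_C, if_neg hn.ne']

theorem one : ConvergesOnBall 1 := by
  simpa using const 1

theorem X : ConvergesOnBall (PowerSeries.X) :=
  of_eventually_coeff_eq_zero <| (Filter.eventually_gt_atTop 1).mono fun n hn => by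
    rw [PowerSeries.coeff_X, if_neg hn.ne']

theorem add (hA : ConvergesOnBall A) (hB : ConvergesOnBall B) : ConvergesOnBall (A + B) := by
  intro r h0 h1
  refine ((hA r h0 h1).add (hB r h0 h1)).of_nonneg_of_le (fun n => by positivity) fun n => ?_
  rw [← mul_add, map_add]
  gcongr
  exact norm_add_le _ _

theorem neg (hA : ConvergesOnBall A) : ConvergesOnBall (-A) :=
  hA.of_norm_le fun n => by simp

theorem sub (hA : ConvergesOnBall A) (hB : ConvergesOnBall B) : ConvergesOnBall (A - B) := by
  rw [sub_eq_add_neg]; exact hA.add hB.neg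

theorem mul (hA : ConvergesOnBall A) (hB : ConvergesOnBall B) : ConvergesOnBall (A * B) := by
  intro r h0 h1
  have h := summable_norm_sum_mul_antidiagonal_of_summable_norm
    (f := fun n => r ^ n * ‖PowerSeries.coeff n A‖) (g := fun n => r ^ n * ‖PowerSeries.coeff n B‖)
    (hA r h0 h1).norm (hB r h0 h1).norm
  refine h.of_nonneg_of_le (fun n => by positivity) fun n => le_trans ?_ (le_abs_self _)
  rw [PowerSeries.coeff_mul]
  refine (mul_le_mul_of_nonneg_left (norm_sum_le _ _) (by positivity)).trans ?_
  rw [Finset.mul_sum]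
  refine Finset.sum_le_sum fun p hp => ?_
  rw [← Finset.HasAntidiagonal.mem_antidiagonal.mp hp, norm_mul, pow_add]
  exact le_of_eq (by ring)

end ConvergesOnBall

theorem twistedEval_zero_right (A : PowerSeries ℍ[ℝ]) (q : ℍ[ℝ]) : twistedEval A q 0 = 0 := by
  simp [twistedEval]

theorem twistedEval_add_right (hA : ConvergesOnBall A) (hq : ‖q‖ < 1) (v w : ℍ[ℝ]) :
    twistedEval A q (v + w) = twistedEval A q v + twistedEval A q w :=
  (((hA.hasSum hq v).add (hA.hasSum hq w)).congr_fun fun n => by rw [mul_add, add_mul]).tsum_eq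

theorem twistedEval_mul_right {c : ℍ[ℝ]} (hc : Commute c q) (A : PowerSeries ℍ[ℝ]) (w : ℍ[ℝ]) :
    twistedEval A q (c * w) = c * twistedEval A q w := by
  rw [twistedEval, twistedEval, ← tsum_mul_left]
  refine tsum_congr fun n => ?_
  rw [← mul_assoc, ← (hc.pow_right n).eq]
  simp only [mul_assoc]

theorem twistedEval_eq_mul (A : PowerSeries ℍ[ℝ]) (q : ℍ[ℝ]) {w : ℍ[ℝ]} (hw : w ≠ 0) :
    twistedEval A q w = w * twistedEval A (w⁻¹ * q * w) 1 := by
  rw [twistedEval, twistedEval, ← tsum_mul_left]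
  refine tsum_congr fun n => ?_
  rw [GroupWithZero.conj_pow₀ hw, mul_one]
  simp only [← mul_assoc, mul_inv_cancel₀ hw, one_mul]

theorem norm_twistedEval_le {M : ℝ} (h : ∀ p : ℍ[ℝ], ‖p‖ < 1 → ‖twistedEval A p 1‖ ≤ M)
    (hq : ‖q‖ < 1) (w : ℍ[ℝ]) : ‖twistedEval A q w‖ ≤ M * ‖w‖ := by
  rcases eq_or_ne w 0 with rfl | hw
  · simp [twistedEval_zero_right]
  · rw [twistedEval_eq_mul A q hw, norm_mul, mul_comm]
    gcongr
    exact h _ (by rwa [norm_inv_mul_mul q hw])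

theorem twistedEval_sub (hA : ConvergesOnBall A) (hB : ConvergesOnBall B) (hq : ‖q‖ < 1)
    (w : ℍ[ℝ]) : twistedEval (A - B) q w = twistedEval A q w - twistedEval B q w :=
  (((hA.hasSum hq w).sub (hB.hasSum hq w)).congr_fun fun n => by rw [map_sub, mul_sub]).tsum_eq

theorem twistedEval_C (c q w : ℍ[ℝ]) : twistedEval (C c) q w = w * c := by
  rw [twistedEval, tsum_eq_single 0 fun n hn => by rw [PowerSeries.coeff_C, if_neg hn, mul_zero]]
  simp

theorem twistedEval_one (q w : ℍ[ℝ]) : twistedEval 1 q w = w := by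
  simpa using twistedEval_C 1 q w

theorem twistedEval_X (q w : ℍ[ℝ]) : twistedEval X q w = q * w := by
  rw [twistedEval, tsum_eq_single 1 fun n hn => by rw [PowerSeries.coeff_X, if_neg hn, mul_zero]]
  simp

theorem pow_mul_mul_coeff_mul (A B : PowerSeries ℍ[ℝ]) (q w : ℍ[ℝ]) (n : ℕ) :
    q ^ n * w * PowerSeries.coeff n (A * B) = ∑ p ∈ Finset.HasAntidiagonal.antidiagonal n,
      q ^ p.2 * (q ^ p.1 * w * PowerSeries.coeff p.1 A) * PowerSeries.coeff p.2 B := by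
  rw [PowerSeries.coeff_mul, Finset.mul_sum]
  refine Finset.sum_congr rfl fun p hp => ?_
  rw [← Finset.HasAntidiagonal.mem_antidiagonal.mp hp, add_comm, pow_add]
  simp only [mul_assoc]

theorem twistedEval_mul (hA : ConvergesOnBall A) (hB : ConvergesOnBall B) (hq : ‖q‖ < 1)
    (w : ℍ[ℝ]) : twistedEval (A * B) q w = twistedEval B q (twistedEval A q w) := by
  set term : ℕ × ℕ → ℍ[ℝ] := fun p =>
    q ^ p.2 * (q ^ p.1 * w * PowerSeries.coeff p.1 A) * PowerSeries.coeff p.2 B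
  have hterm : Summable term := by
    refine (((hA.summable_norm hq w).mul_of_nonneg (hB.summable_norm hq 1)
      (fun _ => norm_nonneg _) (fun _ => norm_nonneg _)).congr fun p => ?_).of_norm
    simp only [term, norm_mul, norm_pow, norm_one]
    ring
  have hdiag : HasSum (fun n => q ^ n * w * PowerSeries.coeff n (A * B)) (∑' p, term p) :=
    (Finset.HasAntidiagonal.sigmaAntidiagonalEquivProd.hasSum_iff.mpr hterm.hasSum).sigma
      fun n => by
        rw [pow_mul_mul_coeff_mul, ← Finset.sum_coe_sort]
        exact hasSum_fintype _
  have hrows : HasSum (fun m => q ^ m * twistedEval A q w * PowerSeries.coeff m B)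
      (∑' p, term p) :=
    ((Equiv.prodComm ℕ ℕ).hasSum_iff.mpr hterm.hasSum).prod_fiberwise fun m =>
      ((hA.hasSum hq w).mul_left (q ^ m)).mul_right (PowerSeries.coeff m B)
  exact hdiag.tsum_eq.trans hrows.tsum_eq.symm

theorem continuousAt_twistedEval (hA : ConvergesOnBall A) (hq : ‖q‖ < 1) (w : ℍ[ℝ]) :
    ContinuousAt (fun p => twistedEval A p w) q := by
  obtain ⟨r, hqr, hr1⟩ := exists_between hq
  have hr0 := (norm_nonneg q).trans hqr.le
  have hc : ContinuousOn (fun p => twistedEval A p w) (Metric.ball 0 r) := by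
    refine continuousOn_tsum (u := fun n => ‖w‖ * (r ^ n * ‖PowerSeries.coeff n A‖))
      (fun n => by fun_prop) ((hA r hr0 hr1).mul_left _) fun n p hp => ?_
    rw [norm_pow_mul_mul_coeff]
    have : ‖p‖ ≤ r := by simpa using (Metric.mem_ball.mp hp).le
    gcongr
  exact hc.continuousAt (Metric.isOpen_ball.mem_nhds (by simpa using hqr))

/-- `f` is the sum of the power series `A` in the unit ball. -/
def HasPowerSeries (f : ℍ[ℝ] → ℍ[ℝ]) (A : PowerSeries ℍ[ℝ]) : Prop :=
  HasExpansion f fun n => PowerSeries.coeff n A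

namespace HasPowerSeries

variable {f g : ℍ[ℝ] → ℍ[ℝ]}

theorem convergesOnBall (h : HasPowerSeries f A) : ConvergesOnBall A :=
  .of_summable fun q hq => (h q (mem_unitBall.mpr hq)).summable

theorem eq_twistedEval (h : HasPowerSeries f A) (hq : ‖q‖ < 1) : f q = twistedEval A q 1 := by
  rw [twistedEval, ← (h q (mem_unitBall.mpr hq)).tsum_eq]
  simp only [mul_one]

theorem of_eq (hA : ConvergesOnBall A) (h : ∀ q : ℍ[ℝ], ‖q‖ < 1 → f q = twistedEval A q 1) :
    HasPowerSeries f A := by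
  intro q hq
  rw [mem_unitBall] at hq
  rw [h q hq]
  simpa using hA.hasSum hq 1

theorem coeff_eq (h : HasPowerSeries f A) : coeff f = fun n => PowerSeries.coeff n A :=
  SliceRegular.coeff_eq h

theorem const (c : ℍ[ℝ]) : HasPowerSeries (fun _ => c) (C c) :=
  of_eq (.const c) fun q _ => by rw [twistedEval_C, one_mul]

theorem id : HasPowerSeries (fun q => q) X :=
  of_eq .X fun q _ => by rw [twistedEval_X, mul_one]

theorem sub (hf : HasPowerSeries f A) (hg : HasPowerSeries g B) :
    HasPowerSeries (fun q => f q - g q) (A - B) :=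
  of_eq (hf.convergesOnBall.sub hg.convergesOnBall) fun q hq => by
    rw [twistedEval_sub hf.convergesOnBall hg.convergesOnBall hq, ← hf.eq_twistedEval hq,
      ← hg.eq_twistedEval hq]

theorem regMul_eq (hf : HasPowerSeries f A) (hg : HasPowerSeries g B) (q : ℍ[ℝ]) :
    regMul f g q = twistedEval (A * B) q 1 := by
  rw [regMul, twistedEval, hf.coeff_eq, hg.coeff_eq]
  refine tsum_congr fun n => ?_
  rw [PowerSeries.coeff_mul, mul_one, Finset.Nat.sum_antidiagonal_eq_sum_range_succ_mk]

theorem regMul (hf : HasPowerSeries f A) (hg : HasPowerSeries g B) :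
    HasPowerSeries (regMul f g) (A * B) :=
  of_eq (hf.convergesOnBall.mul hg.convergesOnBall) fun q _ => hf.regMul_eq hg q

end HasPowerSeries

theorem exists_complex_conj_eq (q : ℍ[ℝ]) : ∃ (z : ℂ) (w : ℍ[ℝ]), w ≠ 0 ∧ w⁻¹ * z * w = q := by
  suffices ∃ (z : ℂ) (w : ℍ[ℝ]), w ≠ 0 ∧ (z : ℍ[ℝ]) * w = w * q by
    obtain ⟨z, w, hw, h⟩ := this
    exact ⟨z, w, hw, by rw [mul_assoc, h, inv_mul_cancel_left₀ hw]⟩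
  set r := ‖q.im‖
  have hr : r * r = q.imI * q.imI + q.imJ * q.imJ + q.imK * q.imK := by
    rw [← Quaternion.normSq_eq_norm_mul_self, Quaternion.normSq_def']
    simp only [Quaternion.re_im, Quaternion.imI_im, Quaternion.imJ_im, Quaternion.imK_im]
    ring
  -- `w = Im q + |Im q| i` intertwines `Im q` with `|Im q| i`; it vanishes only on one complex ray.
  by_cases hw : q.im + ((⟨0, r⟩ : ℂ) : ℍ[ℝ]) = 0
  · refine ⟨⟨q.re, q.imI⟩, 1, one_ne_zero, ?_⟩
    have hJ : q.imJ = 0 := by simpa using congrArg QuaternionAlgebra.imJ hw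
    have hK : q.imK = 0 := by simpa using congrArg QuaternionAlgebra.imK hw
    apply Quaternion.ext <;> simp [hJ, hK]
  · refine ⟨⟨q.re, r⟩, _, hw, ?_⟩
    apply Quaternion.ext <;> simp <;> linarith

theorem norm_coeComplex (z : ℂ) : ‖(z : ℍ[ℝ])‖ = ‖z‖ := by
  rw [← sq_eq_sq₀ (norm_nonneg _) (norm_nonneg _), sq, ← Quaternion.normSq_eq_norm_mul_self,
    Quaternion.normSq_def', Complex.sq_norm, Complex.normSq_apply]
  simp [sq]

/-- Left multiplication by the slice `ℝ + iℝ` makes `ℍ` a complex normed space. For `w : ℍ`, the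
function `z ↦ ∑ zⁿ w aₙ` on the disc is then holomorphic, although the right factors `w aₙ` do not
commute with `z`. -/
local instance complexNormedSpace : NormedSpace ℂ ℍ[ℝ] where
  __ := Module.compHom ℍ[ℝ] (Quaternion.ofComplex : ℂ →ₐ[ℝ] ℍ[ℝ]).toRingHom
  norm_smul_le z q := by
    change ‖(z : ℍ[ℝ]) * q‖ ≤ _
    rw [norm_mul, norm_coeComplex]

theorem complex_smul_eq (z : ℂ) (q : ℍ[ℝ]) : z • q = (z : ℍ[ℝ]) * q := rfl

local instance : IsScalarTower ℂ ℍ[ℝ] ℍ[ℝ] :=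
  ⟨fun z p q => mul_assoc (z : ℍ[ℝ]) p q⟩

theorem coeComplex_pow (z : ℂ) (n : ℕ) : ((z ^ n : ℂ) : ℍ[ℝ]) = (z : ℍ[ℝ]) ^ n :=
  map_pow Quaternion.ofComplex z n

theorem differentiableOn_tsum_pow_smul {E : Type*} [NormedAddCommGroup E] [NormedSpace ℂ E]
    [CompleteSpace E] {c : ℕ → E}
    (hc : ∀ r : ℝ, 0 ≤ r → r < 1 → Summable fun n => r ^ n * ‖c n‖) :
    DifferentiableOn ℂ (fun z : ℂ => ∑' n, z ^ n • c n) (Metric.ball 0 1) := by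
  intro z hz
  obtain ⟨r, hzr, hr1⟩ := exists_between (mem_ball_zero_iff.mp hz)
  have hr0 := (norm_nonneg z).trans hzr.le
  have hd : DifferentiableOn ℂ (fun z : ℂ => ∑' n, z ^ n • c n) (Metric.ball 0 r) := by
    refine Complex.differentiableOn_tsum_of_summable_norm (hc r hr0 hr1)
      (fun n => by fun_prop) Metric.isOpen_ball fun n y hy => ?_
    have : ‖y‖ ≤ r := (mem_ball_zero_iff.mp hy).le
    rw [norm_smul, norm_pow]
    gcongr
  have hball : Metric.ball 0 r ∈ 𝓝 z := Metric.isOpen_ball.mem_nhds (by simpa using hzr)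
  exact (hd.differentiableAt hball).differentiableWithinAt

theorem differentiableOn_twistedEval (hA : ConvergesOnBall A) (w : ℍ[ℝ]) :
    DifferentiableOn ℂ (fun z : ℂ => twistedEval A z w) (Metric.ball 0 1) := by
  refine (differentiableOn_tsum_pow_smul (c := fun n => w * PowerSeries.coeff n A)
    fun r h0 h1 => ?_).congr fun z _ => tsum_congr fun n => ?_
  · simp_rw [norm_mul, mul_left_comm _ ‖w‖]
    exact (hA r h0 h1).mul_left _
  · rw [complex_smul_eq, coeComplex_pow, mul_assoc]

theorem norm_coeComplex_lt_one {z : ℂ} (hz : z ∈ Metric.ball (0 : ℂ) 1) : ‖(z : ℍ[ℝ])‖ < 1 := by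
  rwa [norm_coeComplex, ← mem_ball_zero_iff]

theorem eq_zero_of_frequently_twistedEval_eq_zero (hA : ConvergesOnBall A) {w : ℍ[ℝ]} (hw : w ≠ 0)
    {z : ℂ} (hz : ‖z‖ < 1) (h : ∃ᶠ x : ℂ in 𝓝[≠] z, twistedEval A x w = 0) : A = 0 := by
  have hzero : ∀ x ∈ Metric.ball (0 : ℂ) 1, twistedEval A x w = 0 :=
    ((differentiableOn_twistedEval hA w).analyticOnNhd Metric.isOpen_ball
      ).eqOn_zero_of_preconnected_of_frequently_eq_zero (convex_ball _ _).isPreconnected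
      (mem_ball_zero_iff.mpr hz) h
  let p : FormalMultilinearSeries ℂ ℂ ℍ[ℝ] := fun n =>
    ContinuousMultilinearMap.mkPiRing ℂ (Fin n) (w * PowerSeries.coeff n A)
  have hp : ∀ n, p.coeff n = w * PowerSeries.coeff n A := by simp [p, FormalMultilinearSeries.coeff]
  have hseries : HasFPowerSeriesAt 0 p 0 := by
    refine hasFPowerSeriesAt_iff.mpr ?_
    filter_upwards [Metric.ball_mem_nhds (0 : ℂ) one_pos] with x hx
    have hsum := hA.hasSum (norm_coeComplex_lt_one hx) w
    rw [hzero x hx] at hsum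
    exact hsum.congr_fun fun n => by rw [hp, complex_smul_eq, coeComplex_pow, mul_assoc]
  ext1 n
  have := hp n
  rw [hseries.eq_zero] at this
  simpa [hw, FormalMultilinearSeries.coeff] using this.symm

theorem eq_of_forall_twistedEval_eq (hA : ConvergesOnBall A) (hB : ConvergesOnBall B) {w : ℍ[ℝ]}
    (hw : w ≠ 0) (h : ∀ z ∈ Metric.ball (0 : ℂ) 1, twistedEval A z w = twistedEval B z w) :
    A = B := by
  rw [← sub_eq_zero]
  have hmem : ∀ᶠ z : ℂ in 𝓝[≠] 0, z ∈ Metric.ball (0 : ℂ) 1 :=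
    nhdsWithin_le_nhds (Metric.ball_mem_nhds 0 one_pos)
  refine eq_zero_of_frequently_twistedEval_eq_zero (hA.sub hB) hw (z := 0) (by simp)
    (hmem.mono fun z hz => ?_).frequently
  rw [twistedEval_sub hA hB (norm_coeComplex_lt_one hz), h z hz, sub_self]

theorem exists_hasPowerSeries_of_differentiableOn {k : ℂ → ℍ[ℝ]}
    (hk : DifferentiableOn ℂ k (Metric.ball 0 1)) :
    ∃ A, ConvergesOnBall A ∧ ∀ z ∈ Metric.ball (0 : ℂ) 1, twistedEval A z 1 = k z := by
  let A : PowerSeries ℍ[ℝ] := .mk fun n => (n.factorial : ℂ)⁻¹ • iteratedDeriv n k 0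
  have hsum : ∀ z ∈ Metric.ball (0 : ℂ) 1,
      HasSum (fun n => (z : ℍ[ℝ]) ^ n * PowerSeries.coeff n A) (k z) := fun z hz =>
    (Complex.hasSum_taylorSeries_on_ball hk hz).congr_fun fun n => by
      rw [PowerSeries.coeff_mk, sub_zero, smul_comm, complex_smul_eq (z ^ n), coeComplex_pow]
  refine ⟨A, .of_bddAbove fun r h0 h1 => ?_, fun z hz => ?_⟩
  · have hr : (r : ℂ) ∈ Metric.ball 0 1 := by simpa [abs_of_nonneg h0] using h1
    simpa [abs_of_nonneg h0] using (hsum r hr).summable.tendsto_atTop_zero.norm.bddAbove_range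
  · simpa only [twistedEval, mul_one] using (hsum z hz).tsum_eq

local instance : IsScalarTower ℝ ℂ ℍ[ℝ] :=
  ⟨fun r z q => by
    simp only [complex_smul_eq, Complex.real_smul, Quaternion.coeComplex_mul,
      Quaternion.coeComplex_coe, Quaternion.coe_mul_eq_smul, smul_mul_assoc]⟩

local instance : FiniteDimensional ℂ ℍ[ℝ] := .right ℝ ℂ ℍ[ℝ]

/-- Right multiplication by `a`, which is linear over the slice `ℝ + iℝ` acting on the left. -/
def rightMulCLM (a : ℍ[ℝ]) : ℍ[ℝ] →L[ℂ] ℍ[ℝ] :=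
  (LinearMap.mulRight ℂ a).mkContinuous ‖a‖ fun w => by simp [mul_comm]

/-- The operator `w ↦ ∑ zⁿ w aₙ` on `ℍ`, for `z` in the disc of the slice `ℝ + iℝ`. -/
def twistedEvalCLM (A : PowerSeries ℍ[ℝ]) (z : ℂ) : ℍ[ℝ] →L[ℂ] ℍ[ℝ] :=
  ∑' n, z ^ n • rightMulCLM (PowerSeries.coeff n A)

theorem norm_rightMulCLM_le (a : ℍ[ℝ]) : ‖rightMulCLM a‖ ≤ ‖a‖ :=
  LinearMap.mkContinuous_norm_le _ (norm_nonneg a) _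

theorem summable_norm_rightMulCLM (hA : ConvergesOnBall A) {r : ℝ} (h0 : 0 ≤ r) (h1 : r < 1) :
    Summable fun n => r ^ n * ‖rightMulCLM (PowerSeries.coeff n A)‖ :=
  (hA r h0 h1).of_nonneg_of_le (fun n => by positivity) fun n => by
    gcongr
    exact norm_rightMulCLM_le _

theorem twistedEvalCLM_apply (hA : ConvergesOnBall A) {z : ℂ} (hz : ‖z‖ < 1) (w : ℍ[ℝ]) :
    twistedEvalCLM A z w = twistedEval A z w := by
  have hsum : Summable fun n => z ^ n • rightMulCLM (PowerSeries.coeff n A) :=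
    .of_norm <| by
      simpa only [norm_smul, norm_pow] using summable_norm_rightMulCLM hA (norm_nonneg z) hz
  have happly := hsum.hasSum.mapL (ContinuousLinearMap.apply ℂ ℍ[ℝ] w)
  refine happly.tsum_eq.symm.trans (tsum_congr fun n => ?_)
  change z ^ n • (w * PowerSeries.coeff n A) = _
  rw [complex_smul_eq, coeComplex_pow, mul_assoc]

theorem isUnit_twistedEvalCLM (hA : ConvergesOnBall A)
    (h0 : ∀ q : ℍ[ℝ], ‖q‖ < 1 → twistedEval A q 1 ≠ 0) {z : ℂ} (hz : ‖z‖ < 1) :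
    IsUnit (twistedEvalCLM A z) := by
  rw [ContinuousLinearMap.isUnit_iff_isUnit_toLinearMap, LinearMap.isUnit_iff_ker_eq_bot,
    LinearMap.ker_eq_bot']
  intro w hw
  by_contra hw0
  have hz' : ‖w⁻¹ * (z : ℍ[ℝ]) * w‖ < 1 := by rwa [norm_inv_mul_mul _ hw0, norm_coeComplex]
  refine mul_ne_zero hw0 (h0 _ hz') ?_
  rw [← twistedEval_eq_mul A _ hw0, ← twistedEvalCLM_apply hA hz]
  exact hw

theorem exists_mul_eq_one_of_forall_ne_zero (hA : ConvergesOnBall A)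
    (h0 : ∀ q : ℍ[ℝ], ‖q‖ < 1 → twistedEval A q 1 ≠ 0) :
    ∃ B, ConvergesOnBall B ∧ B * A = 1 := by
  have hunit : ∀ z ∈ Metric.ball (0 : ℂ) 1, IsUnit (twistedEvalCLM A z) := fun z hz =>
    isUnit_twistedEvalCLM hA h0 (mem_ball_zero_iff.mp hz)
  have hdiff : DifferentiableOn ℂ (twistedEvalCLM A) (Metric.ball 0 1) :=
    differentiableOn_tsum_pow_smul fun _ => summable_norm_rightMulCLM hA
  obtain ⟨B, hB, hBinv⟩ := exists_hasPowerSeries_of_differentiableOn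
    ((hdiff.inverse hunit).clm_apply (differentiableOn_const (1 : ℍ[ℝ])))
  refine ⟨B, hB, eq_of_forall_twistedEval_eq (hB.mul hA) .one one_ne_zero fun z hz => ?_⟩
  have hz1 := mem_ball_zero_iff.mp hz
  rw [twistedEval_mul hB hA (norm_coeComplex_lt_one hz), hBinv z hz, twistedEval_one,
    ← twistedEvalCLM_apply hA hz1, ← mul_apply_eq_comp,
    Ring.mul_inverse_cancel _ (hunit z hz), one_apply_eq_self]

theorem eq_of_isMaxOn_norm {k : ℂ → ℍ[ℝ]} (hk : DifferentiableOn ℂ k (Metric.ball 0 1)) {c : ℂ}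
    (hc : c ∈ Metric.ball 0 1) (hmax : IsMaxOn (norm ∘ k) (Metric.ball 0 1) c) {z : ℂ}
    (hz : z ∈ Metric.ball 0 1) : k z = k c := by
  have hconn := (convex_ball (0 : ℂ) 1).isPreconnected
  have hnorm : ‖k z‖ = ‖k c‖ :=
    Complex.norm_eqOn_of_isPreconnected_of_isMaxOn hconn Metric.isOpen_ball hk hc hmax hz
  have hnorm_add : ‖k z + k c‖ = ‖k c + k c‖ :=
    Complex.norm_eqOn_of_isPreconnected_of_isMaxOn hconn Metric.isOpen_ball
      (hk.add_const (k c)) hc hmax.norm_add_self hz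
  have hlaw := parallelogram_law_with_norm ℝ (k z) (k c)
  rw [hnorm_add, hnorm, ← two_smul ℝ, norm_smul, Real.norm_two] at hlaw
  rw [← sub_eq_zero, ← norm_eq_zero, ← sq_eq_zero_iff]
  linarith

theorem eq_C_of_norm_twistedEval_le (hA : ConvergesOnBall A) {p : ℍ[ℝ]} (hp : ‖p‖ < 1)
    (hmax : ∀ q : ℍ[ℝ], ‖q‖ < 1 → ‖twistedEval A q 1‖ ≤ ‖twistedEval A p 1‖) :
    A = C (twistedEval A p 1) := by
  obtain ⟨c, w, hw, rfl⟩ := exists_complex_conj_eq p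
  rw [norm_inv_mul_mul _ hw] at hp
  have hc : c ∈ Metric.ball (0 : ℂ) 1 := by rwa [mem_ball_zero_iff, ← norm_coeComplex]
  refine eq_of_forall_twistedEval_eq hA (.const _) hw fun z hz => ?_
  rw [twistedEval_C, ← twistedEval_eq_mul A _ hw]
  refine eq_of_isMaxOn_norm (differentiableOn_twistedEval hA w) hc (fun x hx => ?_) hz
  rw [Set.mem_ofPred_eq, Function.comp_apply, Function.comp_apply, twistedEval_eq_mul A c hw,
    norm_mul, mul_comm]
  exact norm_twistedEval_le hmax (norm_coeComplex_lt_one hx) w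

section Expansion

theorem differentiableAt_complex_of_hasFDerivAt {k : ℂ → ℍ[ℝ]} {k' : ℂ →L[ℝ] ℍ[ℝ]} {z : ℂ}
    (hk : HasFDerivAt k k' z) (hI : k' Complex.I = (Complex.I : ℂ) * k' 1) :
    DifferentiableAt ℂ k z := by
  refine (hasFDerivAt_of_restrictScalars ℝ hk
    (f' := (1 : ℂ →L[ℂ] ℂ).smulRight (k' 1)) ?_).differentiableAt
  refine ContinuousLinearMap.ext fun y => ?_
  have hy : y = y.re • (1 : ℂ) + y.im • Complex.I := by simp
  conv_rhs => rw [hy, map_add, map_smul, map_smul, hI]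
  change y • k' 1 = _
  conv_lhs => rw [hy, add_smul, smul_assoc, smul_assoc, one_smul, complex_smul_eq]

theorem coeComplex_neg_one : ((-1 : ℂ) : ℍ[ℝ]) = -1 :=
  map_neg Quaternion.ofComplex 1

theorem inv_mul_I_mul_mem_imaginaryUnits {w : ℍ[ℝ]} (hw : w ≠ 0) :
    w⁻¹ * (Complex.I : ℂ) * w ∈ imaginaryUnits := by
  change (w⁻¹ * (Complex.I : ℂ) * w) ^ 2 = -1
  rw [GroupWithZero.conj_pow₀ hw, ← coeComplex_pow, Complex.I_sq, coeComplex_neg_one]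
  simp [hw]

theorem coe_re_add_inv_mul_I_mul_im {w : ℍ[ℝ]} (hw : w ≠ 0) (z : ℂ) :
    (z.re : ℍ[ℝ]) + w⁻¹ * (Complex.I : ℂ) * w * (z.im : ℍ[ℝ]) = w⁻¹ * z * w := by
  have hz : (z : ℍ[ℝ]) = (z.re : ℍ[ℝ]) + (Complex.I : ℂ) * (z.im : ℍ[ℝ]) := by
    apply Quaternion.ext <;> simp
  rw [hz, mul_add, add_mul, ← Quaternion.coe_commutes z.re w⁻¹,
    mul_assoc (z.re : ℍ[ℝ]) w⁻¹ w, inv_mul_cancel₀ hw, mul_one]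
  simp only [mul_assoc, Quaternion.coe_commutes z.im w]

variable {f : ℍ[ℝ] → ℍ[ℝ]}

theorem partialX_eq {I : ℍ[ℝ]} {x y : ℝ} {f' : ℝ × ℝ →L[ℝ] ℍ[ℝ]}
    (hf : HasFDerivAt (fun p : ℝ × ℝ => f ((p.1 : ℍ[ℝ]) + I * (p.2 : ℍ[ℝ]))) f' (x, y)) :
    partialX f I x y = f' (1, 0) :=
  (hf.comp_hasDerivAt (f := fun s : ℝ => (s, y)) x
    ((hasDerivAt_id x).prodMk (hasDerivAt_const x y))).deriv

theorem partialY_eq {I : ℍ[ℝ]} {x y : ℝ} {f' : ℝ × ℝ →L[ℝ] ℍ[ℝ]}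
    (hf : HasFDerivAt (fun p : ℝ × ℝ => f ((p.1 : ℍ[ℝ]) + I * (p.2 : ℍ[ℝ]))) f' (x, y)) :
    partialY f I x y = f' (0, 1) :=
  (hf.comp_hasDerivAt (f := fun t : ℝ => (x, t)) y
    ((hasDerivAt_const y x).prodMk (hasDerivAt_id y))).deriv

theorem SliceRegularOn.differentiableOn (hf : SliceRegularOn f unitBall) {w : ℍ[ℝ]} (hw : w ≠ 0) :
    DifferentiableOn ℂ (fun z : ℂ => w * f (w⁻¹ * z * w)) (Metric.ball 0 1) := by
  intro z hz
  set I : ℍ[ℝ] := w⁻¹ * (Complex.I : ℂ) * w with hI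
  have hmem : (z.re : ℍ[ℝ]) + I * (z.im : ℍ[ℝ]) ∈ unitBall := by
    rw [coe_re_add_inv_mul_I_mul_im hw, mem_unitBall, norm_inv_mul_mul _ hw]
    exact norm_coeComplex_lt_one hz
  obtain ⟨hd, hcr⟩ := hf I (inv_mul_I_mul_mem_imaginaryUnits hw) z.re z.im hmem
  set f' := fderiv ℝ (fun p : ℝ × ℝ => f ((p.1 : ℍ[ℝ]) + I * (p.2 : ℍ[ℝ]))) (z.re, z.im)
  have hcr' : f' (1, 0) = -(I * f' (0, 1)) := by
    rw [← partialX_eq hd.hasFDerivAt, ← partialY_eq hd.hasFDerivAt]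
    exact eq_neg_of_add_eq_zero_left ((smul_eq_zero.mp hcr).resolve_left (by norm_num))
  have hk : HasFDerivAt (fun z : ℂ => w * f (w⁻¹ * z * w))
      ((ContinuousLinearMap.mul ℝ ℍ[ℝ] w).comp
        (f'.comp (Complex.equivRealProdCLM : ℂ →L[ℝ] ℝ × ℝ))) z := by
    rw [show (fun z : ℂ => w * f (w⁻¹ * z * w)) = fun z : ℂ => w * f (z.re + I * z.im) from
      funext fun z => by rw [coe_re_add_inv_mul_I_mul_im hw]]
    exact (ContinuousLinearMap.mul ℝ ℍ[ℝ] w).hasFDerivAt.comp z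
      (HasFDerivAt.comp (f := Complex.equivRealProdCLM) z hd.hasFDerivAt
        Complex.equivRealProdCLM.hasFDerivAt)
  refine (differentiableAt_complex_of_hasFDerivAt hk ?_).differentiableWithinAt
  change w * f' (0, 1) = (Complex.I : ℂ) * (w * f' (1, 0))
  have hII : (Complex.I : ℍ[ℝ]) * (w * I) = -w := by
    rw [hI, ← mul_assoc w, ← mul_assoc w, mul_inv_cancel₀ hw, one_mul, ← mul_assoc, ← sq,
      ← coeComplex_pow, Complex.I_sq, coeComplex_neg_one, neg_one_mul]
  rw [hcr', mul_neg, mul_neg, ← mul_assoc w, ← mul_assoc, hII, neg_mul, neg_neg]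

theorem SliceRegularOn.exists_hasPowerSeries (hf : SliceRegularOn f unitBall) :
    ∃ F, HasPowerSeries f F := by
  obtain ⟨F, hF, hFf⟩ := exists_hasPowerSeries_of_differentiableOn
    (hf.differentiableOn (w := 1) one_ne_zero)
  refine ⟨F, .of_eq hF fun q hq => ?_⟩
  obtain ⟨z, w, hw, rfl⟩ := exists_complex_conj_eq q
  rw [norm_inv_mul_mul _ hw, norm_coeComplex, ← mem_ball_zero_iff] at hq
  -- Both sides are holomorphic in `z` and agree for real `z`, where `w⁻¹ * z * w = z`.
  have hslice : Set.EqOn (fun z : ℂ => w * f (w⁻¹ * z * w)) (fun z : ℂ => twistedEval F z w)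
      (Metric.ball 0 1) :=
    ((hf.differentiableOn hw).analyticOnNhd Metric.isOpen_ball
      ).eqOn_of_preconnected_of_frequently_eq
      ((differentiableOn_twistedEval hF w).analyticOnNhd Metric.isOpen_ball)
      (convex_ball _ _).isPreconnected (Metric.mem_ball_self one_pos) ?_
  · exact mul_left_cancel₀ hw ((hslice hq).trans (twistedEval_eq_mul F z hw))
  have hreal : Filter.Tendsto ((↑) : ℝ → ℂ) (𝓝[≠] 0) (𝓝[≠] 0) :=
    Complex.continuous_ofReal.continuousWithinAt.tendsto_nhdsWithin fun t ht => by simpa using ht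
  have hball : ∀ᶠ t : ℝ in 𝓝[≠] 0, (t : ℂ) ∈ Metric.ball (0 : ℂ) 1 :=
    (hreal.mono_right nhdsWithin_le_nhds).eventually (Metric.ball_mem_nhds 0 one_pos)
  refine hreal.frequently (hball.mono fun t ht => ?_).frequently
  have ht1 : twistedEval F t 1 = f t := by simpa using hFf t ht
  rw [twistedEval_eq_mul F _ hw, Quaternion.coeComplex_coe, mul_assoc, Quaternion.coe_commutes,
    inv_mul_cancel_left₀ hw, ht1]

end Expansion

/-- The power series with conjugate coefficients, written `f^c` for the function `f` it sums to. -/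
def conjSeries (A : PowerSeries ℍ[ℝ]) : PowerSeries ℍ[ℝ] :=
  .mk fun n => star (PowerSeries.coeff n A)

theorem coeff_conjSeries (A : PowerSeries ℍ[ℝ]) (n : ℕ) :
    PowerSeries.coeff n (conjSeries A) = star (PowerSeries.coeff n A) :=
  PowerSeries.coeff_mk _ _

theorem conjSeries_conjSeries (A : PowerSeries ℍ[ℝ]) : conjSeries (conjSeries A) = A := by
  ext1 n
  rw [coeff_conjSeries, coeff_conjSeries, star_star]

theorem conjSeries_ne_zero (hA : A ≠ 0) : conjSeries A ≠ 0 := by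
  contrapose! hA
  rw [← conjSeries_conjSeries A, hA]
  ext1 n
  simp [coeff_conjSeries]

theorem conjSeries_mul (A B : PowerSeries ℍ[ℝ]) :
    conjSeries (A * B) = conjSeries B * conjSeries A := by
  ext1 n
  simp only [coeff_conjSeries, PowerSeries.coeff_mul, star_sum, star_mul]
  rw [← Finset.Nat.sum_antidiagonal_swap]
  rfl

theorem coeff_mul_conjSeries (A : PowerSeries ℍ[ℝ]) (n : ℕ) :
    PowerSeries.coeff n (A * conjSeries A) =
      ((PowerSeries.coeff n (A * conjSeries A)).re : ℍ[ℝ]) := by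
  refine Quaternion.star_eq_self.mp ?_
  rw [← coeff_conjSeries, conjSeries_mul, conjSeries_conjSeries]

theorem mul_conjSeries_mul (A B : PowerSeries ℍ[ℝ]) :
    A * conjSeries A * B = B * (A * conjSeries A) := by
  ext1 n
  rw [PowerSeries.coeff_mul, PowerSeries.coeff_mul, ← Finset.Nat.sum_antidiagonal_swap]
  refine Finset.sum_congr rfl fun p _ => ?_
  rw [Prod.fst_swap, Prod.snd_swap, coeff_mul_conjSeries, Quaternion.coe_commutes]

theorem conjSeries_mul_self (A : PowerSeries ℍ[ℝ]) : conjSeries A * A = A * conjSeries A := by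
  rcases eq_or_ne A 0 with rfl | hA
  · rw [zero_mul, mul_zero]
  · refine mul_right_cancel₀ (conjSeries_ne_zero hA) ?_
    rw [mul_conjSeries_mul, mul_assoc]

theorem commute_twistedEval_mul_conjSeries (A : PowerSeries ℍ[ℝ]) (q : ℍ[ℝ]) :
    Commute (twistedEval (A * conjSeries A) q 1) q := by
  refine Commute.tsum_left _ fun n => ?_
  rw [mul_one, coeff_mul_conjSeries]
  exact ((Commute.refl q).pow_left n).mul_left (Quaternion.coe_commute _ q)

theorem ConvergesOnBall.conjSeries (hA : ConvergesOnBall A) :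
    ConvergesOnBall (SliceRegular.conjSeries A) :=
  hA.of_norm_le fun n => by rw [coeff_conjSeries, norm_star]

namespace HasPowerSeries

variable {f u v : ℍ[ℝ] → ℍ[ℝ]} {U V H : PowerSeries ℍ[ℝ]}

theorem regConj (hf : HasPowerSeries f A) : HasPowerSeries (regConj f) (conjSeries A) :=
  of_eq hf.convergesOnBall.conjSeries fun q _ => by
    simp only [SliceRegular.regConj, twistedEval, hf.coeff_eq, coeff_conjSeries, mul_one]

theorem regSymm_eq (hu : HasPowerSeries u U) (q : ℍ[ℝ]) :
    regSymm u q = twistedEval (U * conjSeries U) q 1 :=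
  hu.regMul_eq hu.regConj q

theorem leftQuotient_eq_iff (hu : HasPowerSeries u U) (hv : HasPowerSeries v V)
    (hH : ConvergesOnBall H) (hq : ‖q‖ < 1) (h0 : regSymm u q ≠ 0) :
    leftQuotient u v q = twistedEval H q 1 ↔
      twistedEval (V - U * H) q (twistedEval (conjSeries U) q 1) = 0 := by
  have hU := hu.convergesOnBall
  have hUc := hU.conjSeries
  have hdenom : regSymm u q * twistedEval H q 1 =
      twistedEval (U * H) q (twistedEval (conjSeries U) q 1) := by
    rw [← twistedEval_mul hUc (hU.mul hH) hq, ← mul_assoc, conjSeries_mul_self,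
      twistedEval_mul (hU.mul hUc) hH hq, hu.regSymm_eq, ← twistedEval_mul_right
      (commute_twistedEval_mul_conjSeries U q), mul_one]
  rw [leftQuotient, inv_mul_eq_iff_eq_mul₀ h0, hdenom, hu.regConj.regMul_eq hv,
    twistedEval_mul hUc hv.convergesOnBall hq, twistedEval_sub hv.convergesOnBall (hU.mul hH) hq,
    sub_eq_zero]

theorem mem_closure_quotientDomain (hu : HasPowerSeries u U) (hU : U ≠ 0) (hq : ‖q‖ < 1) :
    q ∈ closure (quotientDomain u) := by
  obtain ⟨z, w, hw, rfl⟩ := exists_complex_conj_eq q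
  have hz : ‖z‖ < 1 := by rwa [norm_inv_mul_mul _ hw, norm_coeComplex] at hq
  by_contra hmem
  have hcoe : Continuous fun x : ℂ => (x : ℍ[ℝ]) :=
    (continuous_id.smul continuous_const).congr fun x => mul_one (x : ℍ[ℝ])
  have hconj : Continuous fun x : ℂ => w⁻¹ * (x : ℍ[ℝ]) * w := by fun_prop
  have hout : ∀ᶠ x : ℂ in 𝓝[≠] z, w⁻¹ * (x : ℍ[ℝ]) * w ∉ quotientDomain u :=
    nhdsWithin_le_nhds <| hconj.continuousAt.eventually
      ((mem_closure_iff_frequently.not.trans Filter.not_frequently).mp hmem)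
  have hball : ∀ᶠ x : ℂ in 𝓝[≠] z, x ∈ Metric.ball (0 : ℂ) 1 :=
    nhdsWithin_le_nhds (Metric.isOpen_ball.mem_nhds (by simpa using hz))
  refine mul_ne_zero hU (conjSeries_ne_zero hU) <| eq_zero_of_frequently_twistedEval_eq_zero
    (hu.convergesOnBall.mul hu.convergesOnBall.conjSeries) hw hz
    ((hout.and hball).mono fun x hx => ?_).frequently
  have hx1 : w⁻¹ * (x : ℍ[ℝ]) * w ∈ unitBall := by
    rw [mem_unitBall, norm_inv_mul_mul _ hw]
    exact norm_coeComplex_lt_one hx.2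
  rw [twistedEval_eq_mul _ _ hw, ← hu.regSymm_eq, not_not.mp (not_and.mp hx.1 hx1), mul_zero]

end HasPowerSeries

section DifferentialQuotient

/-- The value at `a` of the series `∑ qᵐ aₘ₊ₖ` left over when the terms of degree below `k` are
dropped and `qᵏ` is divided out. -/
def tailEval (a : ℍ[ℝ]) (A : PowerSeries ℍ[ℝ]) (k : ℕ) : ℍ[ℝ] :=
  ∑' m, a ^ m * PowerSeries.coeff (m + k) A

/-- The series `G` with `A - A(a) = (q - a) * G`; if `A` is the series of `f`, it is that of the
differential quotient of `f` at `a`. -/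
def dividedDifference (a : ℍ[ℝ]) (A : PowerSeries ℍ[ℝ]) : PowerSeries ℍ[ℝ] :=
  .mk fun n => tailEval a A (n + 1)

variable {a : ℍ[ℝ]}

theorem tailEval_zero (a : ℍ[ℝ]) (A : PowerSeries ℍ[ℝ]) : tailEval a A 0 = twistedEval A a 1 := by
  simp only [tailEval, twistedEval, mul_one, add_zero]

theorem pow_mul_norm_pow_mul_coeff_le {s : ℝ} (has : ‖a‖ ≤ s) (A : PowerSeries ℍ[ℝ]) (k m : ℕ) :
    s ^ k * ‖a ^ m * PowerSeries.coeff (m + k) A‖ ≤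
      s ^ (m + k) * ‖PowerSeries.coeff (m + k) A‖ := by
  have hs0 := (norm_nonneg a).trans has
  rw [norm_mul, norm_pow, add_comm m k, pow_add, mul_assoc]
  gcongr

theorem summable_norm_pow_mul_coeff_add (hA : ConvergesOnBall A) (ha : ‖a‖ < 1) (k : ℕ) :
    Summable fun m => ‖a ^ m * PowerSeries.coeff (m + k) A‖ := by
  obtain ⟨s, has, hs1⟩ := exists_between ha
  have hs0 : 0 < s := (norm_nonneg a).trans_lt has
  refine (summable_mul_left_iff (pow_ne_zero k hs0.ne')).mp ?_
  exact ((summable_nat_add_iff k).mpr (hA s hs0.le hs1)).of_nonneg_of_le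
    (fun m => by positivity) (pow_mul_norm_pow_mul_coeff_le has.le A k)

theorem tailEval_eq_add (hA : ConvergesOnBall A) (ha : ‖a‖ < 1) (k : ℕ) :
    tailEval a A k = PowerSeries.coeff k A + a * tailEval a A (k + 1) := by
  rw [tailEval, (summable_norm_pow_mul_coeff_add hA ha k).of_norm.tsum_eq_zero_add, tailEval,
    ← tsum_mul_left]
  simp only [pow_zero, one_mul, zero_add, pow_succ', mul_assoc, add_assoc, add_comm 1 k]

theorem pow_mul_norm_tailEval_le (hA : ConvergesOnBall A) {s : ℝ} (has : ‖a‖ ≤ s) (hs : s < 1)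
    (k : ℕ) : s ^ k * ‖tailEval a A k‖ ≤ ∑' n, s ^ n * ‖PowerSeries.coeff n A‖ := by
  have hs0 := (norm_nonneg a).trans has
  have hsum := summable_norm_pow_mul_coeff_add hA (has.trans_lt hs) k
  calc s ^ k * ‖tailEval a A k‖
      ≤ s ^ k * ∑' m, ‖a ^ m * PowerSeries.coeff (m + k) A‖ := by
        gcongr
        exact norm_tsum_le_tsum_norm hsum
    _ = ∑' m, s ^ k * ‖a ^ m * PowerSeries.coeff (m + k) A‖ := tsum_mul_left.symm
    _ ≤ ∑' m, s ^ (m + k) * ‖PowerSeries.coeff (m + k) A‖ :=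
        (hsum.mul_left _).tsum_le_tsum (pow_mul_norm_pow_mul_coeff_le has A k)
          ((summable_nat_add_iff k).mpr (hA s hs0 hs))
    _ ≤ ∑' n, s ^ n * ‖PowerSeries.coeff n A‖ := by
        rw [← (hA s hs0 hs).sum_add_tsum_nat_add k]
        exact le_add_of_nonneg_left (Finset.sum_nonneg fun i _ => by positivity)

theorem ConvergesOnBall.dividedDifference (hA : ConvergesOnBall A) (ha : ‖a‖ < 1) :
    ConvergesOnBall (dividedDifference a A) := by
  refine .of_bddAbove fun r hr0 hr1 => ?_
  obtain ⟨s, hs, hs1⟩ := exists_between (max_lt hr1 ha)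
  obtain ⟨hrs, has⟩ := max_lt_iff.mp hs
  have hs0 : 0 < s := hr0.trans_lt hrs
  refine ⟨s⁻¹ * ∑' n, s ^ n * ‖PowerSeries.coeff n A‖, ?_⟩
  rintro _ ⟨n, rfl⟩
  simp only [SliceRegular.dividedDifference, PowerSeries.coeff_mk]
  rw [le_inv_mul_iff₀ hs0]
  calc s * (r ^ n * ‖tailEval a A (n + 1)‖)
      ≤ s * (s ^ n * ‖tailEval a A (n + 1)‖) := by gcongr
    _ = s ^ (n + 1) * ‖tailEval a A (n + 1)‖ := by ring
    _ ≤ _ := pow_mul_norm_tailEval_le hA has.le hs1 (n + 1)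

theorem sub_C_eq_X_sub_C_mul_dividedDifference (hA : ConvergesOnBall A) (ha : ‖a‖ < 1) :
    A - C (twistedEval A a 1) = (X - C a) * dividedDifference a A := by
  rw [← tailEval_zero]
  ext1 n
  rw [map_sub, sub_mul, map_sub, PowerSeries.coeff_C_mul, dividedDifference, PowerSeries.coeff_mk]
  cases n with
  | zero =>
    rw [PowerSeries.coeff_zero_X_mul, tailEval_eq_add hA ha 0, PowerSeries.coeff_C, if_pos rfl,
      zero_add]
    abel
  | succ n =>
    rw [PowerSeries.coeff_succ_X_mul, PowerSeries.coeff_mk, tailEval_eq_add hA ha (n + 1),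
      PowerSeries.coeff_C, if_neg n.succ_ne_zero]
    abel

theorem twistedEval_X_sub_C_mul (hA : ConvergesOnBall A) (hq : ‖q‖ < 1) (a w : ℍ[ℝ]) :
    twistedEval ((X - C a) * A) q w = twistedEval A q (q * w - w * a) := by
  rw [twistedEval_mul (.sub .X (.const a)) hA hq, twistedEval_sub .X (.const a) hq,
    twistedEval_X, twistedEval_C]

theorem twistedEval_one_sub_C_mul (hA : ConvergesOnBall A) (hq : ‖q‖ < 1) (a w : ℍ[ℝ]) :
    twistedEval (1 - C a * A) q w = w - twistedEval A q (w * a) := by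
  rw [twistedEval_sub .one (.mul (.const a) hA) hq, twistedEval_one,
    twistedEval_mul (.const a) hA hq, twistedEval_C]

theorem twistedEval_one_sub_C_mul_X (hq : ‖q‖ < 1) (a w : ℍ[ℝ]) :
    twistedEval (1 - C a * X) q w = w - q * (w * a) := by
  rw [twistedEval_one_sub_C_mul .X hq, twistedEval_X]

theorem X_sub_C_ne_zero (a : ℍ[ℝ]) : (X - C a : PowerSeries ℍ[ℝ]) ≠ 0 := fun h => by
  have := congrArg (PowerSeries.coeff 1) h
  simp at this

variable {f : ℍ[ℝ] → ℍ[ℝ]} {F : PowerSeries ℍ[ℝ]}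

namespace HasPowerSeries

theorem sub_C_eq (hf : HasPowerSeries f F) (ha : ‖a‖ < 1) :
    F - C (f a) = (X - C a) * dividedDifference a F := by
  rw [hf.eq_twistedEval ha, sub_C_eq_X_sub_C_mul_dividedDifference hf.convergesOnBall ha]

theorem diffQuotient_eq (hf : HasPowerSeries f F) (ha : ‖a‖ < 1) (hq : ‖q‖ < 1) :
    diffQuotient f a q = twistedEval (dividedDifference a F) q 1 := by
  have hD := hf.convergesOnBall.dividedDifference ha
  have hu := HasPowerSeries.id.sub (.const a)
  refine extendFrom_eq (hu.mem_closure_quotientDomain (X_sub_C_ne_zero a) hq) ?_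
  refine ((continuousAt_twistedEval hD hq 1).tendsto.mono_left nhdsWithin_le_nhds).congr' ?_
  filter_upwards [self_mem_nhdsWithin] with p hp
  have hp1 := mem_unitBall.mp hp.1
  refine ((hu.leftQuotient_eq_iff (hf.sub (.const _)) hD hp1 hp.2).mpr ?_).symm
  rw [hf.sub_C_eq ha, sub_self]
  simp [twistedEval]

theorem eq_add_sub_mul_diffQuotient (hf : HasPowerSeries f F) (ha : ‖a‖ < 1) (hq : ‖q‖ < 1)
    (hc : Commute a q) : f q = f a + (q - a) * diffQuotient f a q := by
  have hD := hf.convergesOnBall.dividedDifference ha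
  have hmul := congrArg (fun A => twistedEval A q 1) (hf.sub_C_eq ha)
  simp only [twistedEval_sub hf.convergesOnBall (.const _) hq, twistedEval_X_sub_C_mul hD hq,
    twistedEval_C, one_mul, mul_one, ← hf.eq_twistedEval hq] at hmul
  rw [hf.diffQuotient_eq ha hq, ← twistedEval_mul_right ((Commute.refl q).sub_left hc), mul_one,
    ← hmul, add_sub_cancel]

end HasPowerSeries

theorem sub_mul_mul_ne_zero {w : ℍ[ℝ]} (ha : ‖a‖ < 1) (hq : ‖q‖ < 1) (hw : w ≠ 0) :
    w - q * (w * a) ≠ 0 := by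
  refine sub_ne_zero.mpr fun h => ?_
  have hnorm : ‖w‖ = ‖q‖ * (‖w‖ * ‖a‖) := by rw [← norm_mul, ← norm_mul, ← h]
  have hw' := norm_pos_iff.mpr hw
  nlinarith [norm_nonneg q, norm_nonneg a, mul_nonneg hw'.le (norm_nonneg a)]

theorem conjSeries_one_sub_C_mul_X (a : ℍ[ℝ]) :
    conjSeries (1 - C (star a) * X) = 1 - C a * X := by
  ext1 n
  rw [coeff_conjSeries, map_sub, map_sub, star_sub, PowerSeries.coeff_C_mul,
    PowerSeries.coeff_C_mul, PowerSeries.coeff_X, PowerSeries.coeff_one]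
  split_ifs <;> simp

theorem hasPowerSeries_one_sub_regMul_const (hf : HasPowerSeries f F) (c : ℍ[ℝ]) :
    HasPowerSeries (fun p => 1 - regMul (fun _ => c) f p) (1 - C c * F) := by
  simpa using (HasPowerSeries.const 1).sub ((HasPowerSeries.const c).regMul hf)

theorem regSymm_one_sub_regMul_const_ne_zero (ha : ‖a‖ < 1) (hq : ‖q‖ < 1) :
    regSymm (fun p => 1 - regMul (fun _ => star a) (fun p => p) p) q ≠ 0 := by
  have hU (b : ℍ[ℝ]) : ConvergesOnBall (1 - C b * X) := .sub .one (.mul (.const b) .X)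
  rw [(hasPowerSeries_one_sub_regMul_const .id (star a)).regSymm_eq, conjSeries_one_sub_C_mul_X,
    twistedEval_mul (hU _) (hU _) hq, twistedEval_one_sub_C_mul_X hq,
    twistedEval_one_sub_C_mul_X hq]
  exact sub_mul_mul_ne_zero ha hq (sub_mul_mul_ne_zero (by rwa [norm_star]) hq one_ne_zero)

theorem one_sub_C_star_mul_sub_mul {G : PowerSeries ℍ[ℝ]} (h : F - C a = (X - C a) * G) :
    1 - C (star a) * F - (1 - C (star a) * X) * G =
      C ((1 - Quaternion.normSq a : ℝ) : ℍ[ℝ]) * (1 - G) := by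
  rw [Quaternion.coe_sub, Quaternion.coe_one, ← Quaternion.star_mul_self, map_sub, map_mul,
    map_one, sub_eq_iff_eq_add.mp h]
  noncomm_ring

theorem one_sub_normSq_ne_zero (ha : ‖a‖ < 1) : ((1 - Quaternion.normSq a : ℝ) : ℍ[ℝ]) ≠ 0 := by
  have hpos : 0 < 1 - Quaternion.normSq a := by
    rw [Quaternion.normSq_eq_norm_mul_self]
    nlinarith [norm_nonneg a]
  exact Quaternion.coe_injective.ne hpos.ne'

theorem diffQuotient_eq_leftQuotient_iff (hf : HasPowerSeries f F) (ha : ‖a‖ < 1) (hfa : f a = a)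
    (hq : ‖q‖ < 1) :
    diffQuotient f a q = leftQuotient (fun p => 1 - regMul (fun _ => star a) (fun p => p) p)
        (fun p => 1 - regMul (fun _ => star a) f p) q ↔
      diffQuotient f a ((1 - q * a)⁻¹ * q * (1 - q * a)) = 1 := by
  have hD := hf.convergesOnBall.dividedDifference ha
  have hfactor : F - C a = (X - C a) * dividedDifference a F := by rw [← hf.sub_C_eq ha, hfa]
  have he : 1 - q * a ≠ 0 := by simpa using sub_mul_mul_ne_zero ha hq one_ne_zero
  rw [hf.diffQuotient_eq ha hq, eq_comm,
    (hasPowerSeries_one_sub_regMul_const .id (star a)).leftQuotient_eq_iff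
      (hasPowerSeries_one_sub_regMul_const hf _) hD hq
      (regSymm_one_sub_regMul_const_ne_zero ha hq),
    one_sub_C_star_mul_sub_mul hfactor, conjSeries_one_sub_C_mul_X, twistedEval_one_sub_C_mul_X hq,
    one_mul, twistedEval_mul (.const _) (.sub .one hD) hq, twistedEval_C, ← Quaternion.coe_commutes,
    twistedEval_mul_right (Quaternion.coe_commute _ q), twistedEval_eq_mul _ _ he,
    mul_eq_zero_iff_left (one_sub_normSq_ne_zero ha), mul_eq_zero_iff_left he,
    hf.diffQuotient_eq ha (by rwa [norm_inv_mul_mul _ he]),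
    twistedEval_sub .one hD (by rwa [norm_inv_mul_mul _ he]), twistedEval_one, sub_eq_zero, eq_comm]

end DifferentialQuotient

section Derivatives

variable {f : ℍ[ℝ] → ℍ[ℝ]} {F : PowerSeries ℍ[ℝ]} {a c : ℍ[ℝ]}

theorem unitOf_mul_norm_im (q : ℍ[ℝ]) : unitOf q * (‖q.im‖ : ℍ[ℝ]) = q.im := by
  rw [Quaternion.mul_coe_eq_smul, unitOf]
  split_ifs with h
  · simp [h]
  · rw [smul_smul, mul_inv_cancel₀ (norm_ne_zero_iff.mpr h), one_smul]

theorem re_add_unitOf_mul_norm_im (q : ℍ[ℝ]) :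
    (q.re : ℍ[ℝ]) + unitOf q * (‖q.im‖ : ℍ[ℝ]) = q := by
  rw [unitOf_mul_norm_im, Quaternion.re_add_im]

theorem unitOf_mul_self (q : ℍ[ℝ]) : unitOf q * unitOf q = -1 := by
  rw [unitOf]
  split_ifs with h
  · have hI : unitI = coeComplex Complex.I := rfl
    rw [hI, ← Quaternion.coeComplex_mul, Complex.I_mul_I, coeComplex_neg_one]
  · have him : q.im * q.im = -((‖q.im‖ * ‖q.im‖ : ℝ) : ℍ[ℝ]) := by
      rw [← Quaternion.normSq_eq_norm_mul_self, ← Quaternion.self_mul_star, Quaternion.star_im,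
        mul_neg, neg_neg]
    rw [smul_mul_smul_comm, him, smul_neg, ← Quaternion.coe_mul_eq_smul, ← Quaternion.coe_mul,
      mul_mul_mul_comm, inv_mul_cancel₀ (norm_ne_zero_iff.mpr h), one_mul, Quaternion.coe_one]

theorem commute_unitOf (q : ℍ[ℝ]) : Commute q (unitOf q) := by
  conv_lhs => rw [← re_add_unitOf_mul_norm_im q]
  exact (Quaternion.coe_commute q.re (unitOf q)).add_left
    ((Commute.refl _).mul_left (Quaternion.coe_commute _ _))

theorem partialX_eq_of_hasLineDerivAt (h : HasLineDerivAt ℝ f c q 1) :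
    partialX f (unitOf q) q.re ‖q.im‖ = c := by
  rw [HasLineDerivAt, ← sub_self q.re] at h
  rw [partialX, ← (h.comp_sub_const q.re q.re).deriv]
  congr 1 with s : 1
  have hs : (s : ℍ[ℝ]) + unitOf q * (‖q.im‖ : ℍ[ℝ]) =
      (q.re : ℍ[ℝ]) + unitOf q * (‖q.im‖ : ℍ[ℝ]) + (s - q.re) • 1 := by
    rw [← Quaternion.coe_mul_eq_smul, Quaternion.coe_sub]
    noncomm_ring
  rw [hs, re_add_unitOf_mul_norm_im]

theorem partialY_eq_of_hasLineDerivAt (h : HasLineDerivAt ℝ f c q (unitOf q)) :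
    partialY f (unitOf q) q.re ‖q.im‖ = c := by
  rw [HasLineDerivAt, ← sub_self ‖q.im‖] at h
  rw [partialY, ← (h.comp_sub_const ‖q.im‖ ‖q.im‖).deriv]
  congr 1 with s : 1
  have hs : (q.re : ℍ[ℝ]) + unitOf q * (s : ℍ[ℝ]) =
      (q.re : ℍ[ℝ]) + unitOf q * (‖q.im‖ : ℍ[ℝ]) + (s - ‖q.im‖) • unitOf q := by
    rw [← Quaternion.mul_coe_eq_smul, Quaternion.coe_sub]
    noncomm_ring
  rw [hs, re_add_unitOf_mul_norm_im]

theorem cullenDeriv_eq_of_hasLineDerivAt (h1 : HasLineDerivAt ℝ f c q 1)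
    (hI : HasLineDerivAt ℝ f (unitOf q * c) q (unitOf q)) : cullenDeriv f q = c := by
  rw [cullenDeriv, partialX_eq_of_hasLineDerivAt h1, partialY_eq_of_hasLineDerivAt hI, ← mul_assoc,
    unitOf_mul_self, neg_one_mul, sub_neg_eq_add, ← two_smul ℝ, smul_smul]
  norm_num

theorem cullenDeriv_eq_one_of_hasFDerivAt
    (h : HasFDerivAt f (ContinuousLinearMap.id ℝ ℍ[ℝ]) q) : cullenDeriv f q = 1 :=
  cullenDeriv_eq_of_hasLineDerivAt (h.hasLineDerivAt 1) <| by
    simpa using h.hasLineDerivAt (unitOf q)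

theorem hasDerivAt_add_smul {E : Type*} [NormedAddCommGroup E] [NormedSpace ℝ E] {φ : ℝ → E}
    (hφ : ContinuousAt φ 0) (v : E) : HasDerivAt (fun t : ℝ => v + t • φ t) (φ 0) 0 := by
  rw [hasDerivAt_iff_tendsto_slope]
  refine (hφ.tendsto.mono_left nhdsWithin_le_nhds).congr' ?_
  filter_upwards [self_mem_nhdsWithin] with t ht
  have ht0 : t ≠ 0 := ht
  simp [slope, smul_smul, inv_mul_cancel₀ ht0]

theorem two_mul_im (q : ℍ[ℝ]) : 2 * q.im = q - star q := by
  rw [two_mul]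
  apply Quaternion.ext <;> simp

namespace HasPowerSeries

theorem continuousAt_diffQuotient (hf : HasPowerSeries f F) (ha : ‖a‖ < 1) (hq : ‖q‖ < 1) :
    ContinuousAt (diffQuotient f a) q := by
  refine (continuousAt_twistedEval (hf.convergesOnBall.dividedDifference ha) hq 1).congr ?_
  filter_upwards [Metric.isOpen_ball.mem_nhds (mem_unitBall.mpr hq)] with p hp
  exact (hf.diffQuotient_eq ha (mem_unitBall.mp hp)).symm

theorem hasLineDerivAt (hf : HasPowerSeries f F) (ha : ‖a‖ < 1) {e : ℍ[ℝ]} (hc : Commute a e) :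
    HasLineDerivAt ℝ f (e * diffQuotient f a a) a e := by
  have hline : ContinuousAt (fun t : ℝ => a + t • e) 0 := by fun_prop
  have h0 : a + (0 : ℝ) • e = a := by simp
  have hφ : ContinuousAt (fun t : ℝ => e * diffQuotient f a (a + t • e)) 0 :=
    continuousAt_const.mul <| ContinuousAt.comp_of_eq (hf.continuousAt_diffQuotient ha ha) hline h0
  have hd := hasDerivAt_add_smul hφ (f a)
  rw [h0] at hd
  refine hd.congr_of_eventuallyEq ?_
  have hball : ∀ᶠ t : ℝ in 𝓝 0, ‖a + t • e‖ < 1 :=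
    hline.norm.eventually_lt_const (by simpa using ha)
  filter_upwards [hball] with t ht
  have hct : Commute a (a + t • e) := (Commute.refl a).add_right (hc.smul_right t)
  rw [hf.eq_add_sub_mul_diffQuotient ha ht hct, add_sub_cancel_left, smul_mul_assoc]

theorem cullenDeriv_eq (hf : HasPowerSeries f F) (ha : ‖a‖ < 1) :
    cullenDeriv f a = diffQuotient f a a :=
  cullenDeriv_eq_of_hasLineDerivAt (by simpa using hf.hasLineDerivAt ha (Commute.one_right a))
    (hf.hasLineDerivAt ha (commute_unitOf a))

theorem sphericalDeriv_eq (hf : HasPowerSeries f F) (ha : ‖a‖ < 1) :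
    sphericalDeriv f a = diffQuotient f a (star a) := by
  rw [sphericalDeriv]
  split_ifs with him
  · have hstar : star a = a := (sub_eq_zero.mp (by rw [← two_mul_im, him, mul_zero])).symm
    rw [hf.cullenDeriv_eq ha, hstar]
  · have hc : Commute a (star a) := by
      rw [Commute, SemiconjBy, Quaternion.self_mul_star, Quaternion.star_mul_self]
    have him2 : 2 * a.im ≠ 0 := by
      rw [two_mul, ← two_smul ℝ]
      exact smul_ne_zero two_ne_zero him
    rw [inv_mul_eq_iff_eq_mul₀ him2, hf.eq_add_sub_mul_diffQuotient ha (by rwa [norm_star]) hc,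
      two_mul_im]
    noncomm_ring

end HasPowerSeries

end Derivatives

section SchwarzPick

variable {F G H : PowerSeries ℍ[ℝ]} {a b v w x : ℍ[ℝ]}

theorem norm_le_of_tendsto_nhdsLT_one {E : Type*} [NormedAddCommGroup E] [NormedSpace ℂ E]
    {k : ℂ → E} (hk : DifferentiableOn ℂ k (Metric.ball 0 1)) {φ : ℝ → ℝ} {M : ℝ}
    (hφ : Filter.Tendsto φ (𝓝[<] 1) (𝓝 M))
    (hbound : ∀ᶠ r in 𝓝[<] 1, ∀ z : ℂ, ‖z‖ = r → ‖k z‖ ≤ φ r) {z : ℂ} (hz : ‖z‖ < 1) :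
    ‖k z‖ ≤ M := by
  refine ge_of_tendsto hφ ?_
  filter_upwards [hbound, Ioo_mem_nhdsLT hz] with r hr hzr
  have hr0 : r ≠ 0 := ((norm_nonneg z).trans_lt hzr.1).ne'
  refine Complex.norm_le_of_forall_mem_frontier_norm_le (U := Metric.ball 0 r) Metric.isBounded_ball
    (DifferentiableOn.diffContOnCl ?_) (fun y hy => hr y ?_) (subset_closure (by simpa using hzr.1))
  · rw [closure_ball _ hr0]
    exact hk.mono (Metric.closedBall_subset_ball hzr.2)
  · rwa [frontier_ball _ hr0, mem_sphere_zero_iff_norm] at hy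

theorem exists_mul_sub_mul_eq (h : ‖a‖ < ‖q‖) (w : ℍ[ℝ]) : ∃ x, q * x - x * a = w := by
  let T : ℍ[ℝ] →ₗ[ℝ] ℍ[ℝ] := LinearMap.mulLeft ℝ q - LinearMap.mulRight ℝ a
  have hT : Function.Injective T := by
    rw [← LinearMap.ker_eq_bot, LinearMap.ker_eq_bot']
    intro x hx
    have hnorm : ‖q‖ * ‖x‖ = ‖a‖ * ‖x‖ := by
      rw [← norm_mul, mul_comm ‖a‖, ← norm_mul]
      exact congrArg norm (sub_eq_zero.mp hx)
    by_contra hx0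
    exact h.ne' (mul_right_cancel₀ (norm_ne_zero_iff.mpr hx0) hnorm)
  exact LinearMap.injective_iff_surjective.mp hT w

theorem norm_add_mul_sq_sub_norm_add_mul_star_sq (v x b : ℍ[ℝ]) :
    ‖v + x * b‖ ^ 2 - ‖x + v * star b‖ ^ 2 = (‖v‖ ^ 2 - ‖x‖ ^ 2) * (1 - ‖b‖ ^ 2) := by
  have hinner : inner ℝ v (x * b) = inner ℝ x (v * star b) := by
    rw [real_inner_comm]
    simp only [Quaternion.inner_def, star_mul, star_star, mul_assoc]
  rw [norm_add_sq_real, norm_add_sq_real, hinner, norm_mul, norm_mul, norm_star]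
  ring

theorem norm_le_of_norm_add_mul_le (hb : ‖b‖ < 1) (h : ‖v + x * b‖ ≤ ‖x + v * star b‖) :
    ‖v‖ ≤ ‖x‖ := by
  have hb2 : 0 < 1 - ‖b‖ ^ 2 := by nlinarith [norm_nonneg b]
  have hsq := pow_le_pow_left₀ (norm_nonneg _) h 2
  have hid := norm_add_mul_sq_sub_norm_add_mul_star_sq v x b
  refine le_of_sq_le_sq ?_ (norm_nonneg x)
  nlinarith

theorem mul_norm_le_of_mul_sub_mul_eq (ha : ‖a‖ < 1) (hq : ‖q‖ < 1)
    (h : q * x - x * a = w - q * (w * star a)) :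
    (‖q‖ ^ 2 - ‖a‖ ^ 2) * ‖x‖ ≤ (2 - ‖q‖ ^ 2 - ‖a‖ ^ 2) * ‖w‖ := by
  have hnorm : ‖w + x * a‖ = ‖q‖ * ‖x + w * star a‖ := by
    rw [← norm_mul, mul_add, sub_eq_sub_iff_add_eq_add.mp h]
  have hid := norm_add_mul_sq_sub_norm_add_mul_star_sq w x a
  have htri : ‖x + w * star a‖ ≤ ‖x‖ + ‖w‖ := by
    refine (norm_add_le _ _).trans (add_le_add_right ?_ _)
    rw [norm_mul, norm_star]
    exact mul_le_of_le_one_right (norm_nonneg w) ha.le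
  have hprod : (‖x‖ + ‖w‖) * ((‖q‖ ^ 2 - ‖a‖ ^ 2) * ‖x‖) ≤
      (‖x‖ + ‖w‖) * ((2 - ‖q‖ ^ 2 - ‖a‖ ^ 2) * ‖w‖) := by
    have hq2 : 0 ≤ 1 - ‖q‖ ^ 2 := by nlinarith [norm_nonneg q]
    have hsq := mul_le_mul_of_nonneg_left (pow_le_pow_left₀ (norm_nonneg _) htri 2) hq2
    rw [hnorm] at hid
    linear_combination hsq + hid
  rcases (add_nonneg (norm_nonneg x) (norm_nonneg w)).eq_or_lt with h0 | hpos
  · have hx0 : ‖x‖ = 0 := by linarith [norm_nonneg x, norm_nonneg w]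
    have hw0 : ‖w‖ = 0 := by linarith
    rw [hx0, hw0, mul_zero, mul_zero]
  · exact le_of_mul_le_mul_left hprod hpos

theorem norm_twistedEval_schwarzPick_le (hF : ConvergesOnBall F) (hG : ConvergesOnBall G)
    (hH : ConvergesOnBall H) (ha : ‖a‖ < 1) (hb : ‖b‖ < 1)
    (hbound : ∀ p : ℍ[ℝ], ‖p‖ < 1 → ‖twistedEval F p 1‖ ≤ 1)
    (hFG : F - C b = (X - C a) * G)
    (hHG : H * (1 - C (star b) * F) = (1 - C (star a) * X) * G)
    (haq : ‖a‖ < ‖q‖) (hq : ‖q‖ < 1) (w : ℍ[ℝ]) :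
    (‖q‖ ^ 2 - ‖a‖ ^ 2) * ‖twistedEval H q w‖ ≤ (2 - ‖q‖ ^ 2 - ‖a‖ ^ 2) * ‖w‖ := by
  -- The series `(q - a) * G` sends `x` to where `(1 - ā * q) * G` sends `w`; as these series are
  -- `F - b` and `H * (1 - b̄ * F)`, it follows that `F` sends `x + v b̄` to `v + x b`.
  obtain ⟨x, hx⟩ := exists_mul_sub_mul_eq haq (w - q * (w * star a))
  set v := twistedEval H q w
  have hv : v - twistedEval F q (v * star b) = twistedEval F q x - x * b := by
    rw [← twistedEval_one_sub_C_mul hF hq, ← twistedEval_mul hH (.sub .one (.mul (.const _) hF)) hq,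
      hHG, twistedEval_mul (.sub .one (.mul (.const _) .X)) hG hq, twistedEval_one_sub_C_mul_X hq,
      ← hx, ← twistedEval_X_sub_C_mul hG hq, ← hFG, twistedEval_sub hF (.const b) hq, twistedEval_C]
  have hvx : v + x * b = twistedEval F q (x + v * star b) := by
    rw [twistedEval_add_right hF hq, ← sub_eq_sub_iff_add_eq_add, hv]
  have hle : ‖v‖ ≤ ‖x‖ := norm_le_of_norm_add_mul_le hb <| by
    simpa [hvx] using norm_twistedEval_le hbound hq (x + v * star b)
  refine le_trans ?_ (mul_norm_le_of_mul_sub_mul_eq ha hq hx)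
  gcongr
  nlinarith [norm_nonneg a]

theorem norm_twistedEval_le_one_of_schwarzPick (hF : ConvergesOnBall F) (hG : ConvergesOnBall G)
    (hH : ConvergesOnBall H) (ha : ‖a‖ < 1) (hb : ‖b‖ < 1)
    (hbound : ∀ p : ℍ[ℝ], ‖p‖ < 1 → ‖twistedEval F p 1‖ ≤ 1)
    (hFG : F - C b = (X - C a) * G)
    (hHG : H * (1 - C (star b) * F) = (1 - C (star a) * X) * G)
    (hq : ‖q‖ < 1) : ‖twistedEval H q 1‖ ≤ 1 := by
  obtain ⟨z, w, hw, rfl⟩ := exists_complex_conj_eq q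
  rw [norm_inv_mul_mul _ hw, norm_coeComplex] at hq
  have hlim : Filter.Tendsto (fun r : ℝ => (2 - r ^ 2 - ‖a‖ ^ 2) / (r ^ 2 - ‖a‖ ^ 2) * ‖w‖)
      (𝓝[<] 1) (𝓝 ‖w‖) := by
    have ha2 : (1 : ℝ) ^ 2 - ‖a‖ ^ 2 ≠ 0 := by nlinarith [norm_nonneg a]
    have hcont : ContinuousAt
        (fun r : ℝ => (2 - r ^ 2 - ‖a‖ ^ 2) / (r ^ 2 - ‖a‖ ^ 2) * ‖w‖) 1 := by
      fun_prop (disch := exact ha2)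
    have hone : (2 - 1 ^ 2 - ‖a‖ ^ 2) / (1 ^ 2 - ‖a‖ ^ 2) * ‖w‖ = ‖w‖ := by
      rw [show (2 : ℝ) - 1 ^ 2 - ‖a‖ ^ 2 = 1 ^ 2 - ‖a‖ ^ 2 by ring, div_self ha2, one_mul]
    simpa only [hone] using hcont.tendsto.mono_left nhdsWithin_le_nhds
  have hle : ‖twistedEval H z w‖ ≤ ‖w‖ := by
    refine norm_le_of_tendsto_nhdsLT_one (differentiableOn_twistedEval hH w) hlim ?_ hq
    filter_upwards [Ioo_mem_nhdsLT ha] with r hr y hy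
    rw [div_mul_eq_mul_div, le_div_iff₀ (by nlinarith [norm_nonneg a, hr.1]), mul_comm, ← hy,
      ← norm_coeComplex]
    rw [← hy, ← norm_coeComplex] at hr
    exact norm_twistedEval_schwarzPick_le hF hG hH ha hb hbound hFG hHG hr.1 hr.2 w
  rw [twistedEval_eq_mul _ _ hw, norm_mul] at hle
  exact (mul_le_iff_le_one_right (norm_pos_iff.mpr hw)).mp hle

end SchwarzPick

section Rigidity

variable {f : ℍ[ℝ] → ℍ[ℝ]} {F G K : PowerSeries ℍ[ℝ]} {a b p w : ℍ[ℝ]}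

theorem twistedEval_one_sub_C_mul_ne_zero (hF : ConvergesOnBall F)
    (hbound : ∀ p : ℍ[ℝ], ‖p‖ < 1 → ‖twistedEval F p 1‖ ≤ 1) (hb : ‖b‖ < 1) (hq : ‖q‖ < 1)
    (hw : w ≠ 0) : twistedEval (1 - C b * F) q w ≠ 0 := by
  rw [twistedEval_one_sub_C_mul hF hq]
  refine sub_ne_zero.mpr fun h => ?_
  have hle := norm_twistedEval_le hbound hq (w * b)
  rw [← h, one_mul, norm_mul] at hle
  exact hle.not_gt (mul_lt_of_lt_one_right (norm_pos_iff.mpr hw) hb)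

theorem exists_mul_one_sub_C_mul_eq (hF : ConvergesOnBall F)
    (hbound : ∀ p : ℍ[ℝ], ‖p‖ < 1 → ‖twistedEval F p 1‖ ≤ 1) (hb : ‖b‖ < 1)
    (hK : ConvergesOnBall K) : ∃ H, ConvergesOnBall H ∧ H * (1 - C b * F) = K := by
  obtain ⟨B, hB, hBinv⟩ := exists_mul_eq_one_of_forall_ne_zero (.sub .one (.mul (.const b) hF))
    fun _ hq => twistedEval_one_sub_C_mul_ne_zero hF hbound hb hq one_ne_zero
  exact ⟨K * B, hK.mul hB, by rw [mul_assoc, hBinv, mul_one]⟩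

theorem eq_one_of_twistedEval_eq_one (hF : ConvergesOnBall F) (hG : ConvergesOnBall G)
    (hbound : ∀ p : ℍ[ℝ], ‖p‖ < 1 → ‖twistedEval F p 1‖ ≤ 1) (ha : ‖a‖ < 1)
    (hFG : F - C a = (X - C a) * G) (hp : ‖p‖ < 1) (hGp : twistedEval G p 1 = 1) : G = 1 := by
  have has : ‖star a‖ < 1 := by rwa [norm_star]
  obtain ⟨H, hH, hHG⟩ := exists_mul_one_sub_C_mul_eq hF hbound has
    (.mul (.sub .one (.mul (.const (star a)) .X)) hG)
  have hHG' : (1 - H) * (1 - C (star a) * F) =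
      C ((1 - Quaternion.normSq a : ℝ) : ℍ[ℝ]) * (1 - G) := by
    rw [sub_mul, one_mul, hHG, one_sub_C_star_mul_sub_mul hFG]
  have hHp : twistedEval H p 1 = 1 := by
    have hzero := congrArg (fun A => twistedEval A p 1) hHG'
    beta_reduce at hzero
    rw [twistedEval_mul (.sub .one hH) (.sub .one (.mul (.const _) hF)) hp,
      twistedEval_mul (.const _) (.sub .one hG) hp, twistedEval_C, ← Quaternion.coe_commutes,
      twistedEval_mul_right (Quaternion.coe_commute _ p), twistedEval_sub .one hG hp,
      twistedEval_one, hGp, sub_self, mul_zero] at hzero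
    by_contra hne
    refine twistedEval_one_sub_C_mul_ne_zero hF hbound has hp ?_ hzero
    rwa [twistedEval_sub .one hH hp, twistedEval_one, sub_ne_zero, ne_comm]
  have hH1 : H = 1 := by
    rw [eq_C_of_norm_twistedEval_le hH hp fun q hq => ?_, hHp, map_one]
    rw [hHp, norm_one]
    exact norm_twistedEval_le_one_of_schwarzPick hF hG hH ha ha hbound hFG hHG hq
  rw [hH1, sub_self, zero_mul, eq_comm, mul_eq_zero_iff_left ?_, sub_eq_zero, eq_comm] at hHG'
  · exact hHG'
  · exact (map_ne_zero_iff _ PowerSeries.C_injective).mpr (one_sub_normSq_ne_zero ha)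

theorem eqOn_id_iff_diffQuotient_eq_one (hf : HasPowerSeries f F)
    (hmaps : Set.MapsTo f unitBall unitBall) (ha : ‖a‖ < 1) (hfa : f a = a) (hp : ‖p‖ < 1) :
    Set.EqOn f id unitBall ↔ diffQuotient f a p = 1 := by
  have hfactor := hf.sub_C_eq ha
  rw [hfa] at hfactor
  have hD := hf.convergesOnBall.dividedDifference ha
  rw [hf.diffQuotient_eq ha hp]
  constructor
  · intro hid
    have hX : HasPowerSeries f X := .of_eq .X fun q hq => by
      rw [twistedEval_X, mul_one, hid (mem_unitBall.mpr hq), id]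
    have hFX : F = X := PowerSeries.ext fun n => congrFun (hf.unique hX) n
    have hD1 : dividedDifference a F = 1 := by
      refine mul_left_cancel₀ (X_sub_C_ne_zero a) ?_
      rw [← hfactor, hFX, mul_one]
    rw [hD1, twistedEval_one]
  · intro hDp q hq
    have hbound : ∀ q : ℍ[ℝ], ‖q‖ < 1 → ‖twistedEval F q 1‖ ≤ 1 := fun q hq => by
      rw [← hf.eq_twistedEval hq]
      exact (mem_unitBall.mp (hmaps (mem_unitBall.mpr hq))).le
    rw [eq_one_of_twistedEval_eq_one hf.convergesOnBall hD hbound ha hfactor hp hDp, mul_one,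
      sub_left_inj] at hfactor
    rw [hf.eq_twistedEval (mem_unitBall.mp hq), hfactor, twistedEval_X, mul_one, id]

theorem eqOn_id_iff_diffQuotient_eq_leftQuotient (hf : HasPowerSeries f F)
    (hmaps : Set.MapsTo f unitBall unitBall) (ha : ‖a‖ < 1) (hfa : f a = a) (hq : ‖q‖ < 1) :
    Set.EqOn f id unitBall ↔ diffQuotient f a q =
      leftQuotient (fun p => 1 - regMul (fun _ => star a) (fun p => p) p)
        (fun p => 1 - regMul (fun _ => star a) f p) q := by
  have hne : 1 - q * a ≠ 0 := by simpa using sub_mul_mul_ne_zero ha hq one_ne_zero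
  rw [diffQuotient_eq_leftQuotient_iff hf ha hfa hq]
  exact eqOn_id_iff_diffQuotient_eq_one hf hmaps ha hfa (by rwa [norm_inv_mul_mul _ hne])

end Rigidity

end SliceRegular

end

open SliceRegular in
theorem mainTheorem4 (f : ℍ[ℝ] → ℍ[ℝ])
    (hreg : SliceRegular.SliceRegularOn f SliceRegular.unitBall)
    (hmaps : Set.MapsTo f SliceRegular.unitBall SliceRegular.unitBall)
    (q₀ : ℍ[ℝ]) (hq₀ : q₀ ∈ SliceRegular.unitBall) (hfix : f q₀ = q₀) :
    List.TFAE
      [ Set.EqOn f id SliceRegular.unitBall,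
        HasFDerivAt f (ContinuousLinearMap.id ℝ ℍ[ℝ]) q₀,
        SliceRegular.cullenDeriv f q₀ = 1,
        SliceRegular.sphericalDeriv f q₀ = 1,
        ∃ q ∈ SliceRegular.unitBall,
          SliceRegular.diffQuotient f q₀ q =
            SliceRegular.leftQuotient
              (fun p => 1 - SliceRegular.regMul (fun _ => star q₀) (fun p => p) p)
              (fun p => 1 - SliceRegular.regMul (fun _ => star q₀) f p) q ] := by
  have ha : ‖q₀‖ < 1 := mem_unitBall.mp hq₀
  obtain ⟨F, hf⟩ := hreg.exists_hasPowerSeries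
  tfae_have 1 → 2 := fun h => (hasFDerivAt_id q₀).congr_of_eventuallyEq
    (h.eventuallyEq_of_mem (Metric.isOpen_ball.mem_nhds hq₀))
  tfae_have 2 → 3 := cullenDeriv_eq_one_of_hasFDerivAt
  tfae_have 1 ↔ 3 := by
    rw [hf.cullenDeriv_eq ha]
    exact eqOn_id_iff_diffQuotient_eq_one hf hmaps ha hfix ha
  tfae_have 1 ↔ 4 := by
    rw [hf.sphericalDeriv_eq ha]
    exact eqOn_id_iff_diffQuotient_eq_one hf hmaps ha hfix (by rwa [norm_star])
  tfae_have 1 → 5 := fun h =>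
    ⟨q₀, hq₀, (eqOn_id_iff_diffQuotient_eq_leftQuotient hf hmaps ha hfix ha).mp h⟩
  tfae_have 5 → 1 := fun ⟨_, hq, h⟩ =>
    (eqOn_id_iff_diffQuotient_eq_leftQuotient hf hmaps ha hfix (mem_unitBall.mp hq)).mpr h
  tfae_finish
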